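/- Let $M$ be a smooth manifold (Hausdorff, $\sigma$-compact, not assumed connected) of even dimension $d=q+p\ge 2$, with a smooth semi-Riemannian metric $g$ of signature $(q,p)$ ($q$ minus signs, $p$ plus signs). \textbf{Orientability.} A \emph{splitting} of $TM$ is a decomposition $TM=E_-\oplus E_+$ into mutually $g$-orthogonal smooth subbundles, with $g$ negative definite on $E_-$ (of rank $q$) and positive definite on $E_+$ (of rank $p$). A smooth subbundle $E\subset TM$ of rank $r$ is \emph{orientable} if $\Lambda^rE^*$ has a nowhere vanishing smooth section (always true if $r=0$). $(M,g)$ is \emph{negative-orientable} (resp. \emph{positive-orientable}) if there is a splitting with $E_-$ (resp. $E_+$) orientable, and \emph{space-and-time orientable} if it is both negative- and positive-orientable. $M$ is orientable if $TM$ is. \textbf{Spinors.} Let $\mathrm{Cl}(T_xM,g_x)$ be the real Clifford algebra with $uv+vu=2g_x(u,v)$, and $\mathbb{C}\mathrm{l}(T_xM)$ its complexification. A \emph{spinor bundle} is a smooth complex vector bundle $S\to M$ with a smooth isomorphism of bundles of complex algebras $\mathbb{C}\mathrm{l}(TM)\cong \mathrm{End}(S)$. Let $\Omega\mapsto\Omega^\times$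 (resp. $\Omega\mapsto\Omega^+$) be the antilinear anti-automorphism of $\mathbb{C}\mathrm{l}(T_xM)$ with $u^\times=u$ (resp. $u^+=-u$) for all $u\in T_xM$. A \emph{nowhere degenerate local Robinson product} (resp. \emph{anti-Robinson product}) on $S$ is a smooth field $x\mapsto H_x$ of non-degenerate hermitian forms on the fibres $S_x$ such that, for all $x\in M$, $\psi,\varphi\in S_x$ and $\Omega\in\mathbb{C}\mathrm{l}(T_xM)$, $$H_x(\psi,\Omega\varphi)=H_x(\Omega^\times\psi,\varphi)\qquad\text{(resp. } H_x(\psi,\Omega\varphi)=H_x(\Omega^+\psi,\varphi)\text{)}.$$ \textbf{Theorem.} Let $S$ be a spinor bundle over $(M,g)$. \begin{enumerate} \item If $q,p$ are even, then $S$ admits a nowhere degenerate local Robinson product if and only if $(M,g)$ is negative-orientable, and a nowhere degenerate local anti-Robinson product if and only if $(M,g)$ is positive-orientable. \item If $q,p$ are odd, then $S$ admits a nowhere degenerate local Robinson product if and only if $(M,g)$ is positive-orientable, and a nowhere degenerate local anti-Robinson product if and only if $(M,g)$ is negative-orientable. \item If $M$ is orientable, the following are equivalent: (a) $(M,g)$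 is space-and-time orientable; (b) $(M,g)$ is negative-orientable; (c) $(M,g)$ is positive-orientable; (d) $S$ admits a nowhere degenerate local Robinson product; (e) $S$ admits a nowhere degenerate local anti-Robinson product. \end{enumerate} -/

import Mathlib

open scoped Manifold ContDiff TensorProduct ComplexConjugate
open Bundle

noncomputable section

namespace SpinGeometry

/-! ## Algebra: the two canonical adjunctions and the products they induce on spinors -/

section Algebra

variable {V : Type*} [AddCommGroup V] [Module ℝ V]

/-- The complexified Clifford algebra of a real quadratic space.  The generators satisfy
`u * v + v * u = 2 g(u, v)`, where `Q v = g(v, v)`. -/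
abbrev ComplexClifford (Q : QuadraticForm ℝ V) : Type _ := ℂ ⊗[ℝ] CliffordAlgebra Q

/-- The embedding of the real vector space into its complexified Clifford algebra. -/
def cliffordVector (Q : QuadraticForm ℝ V) (v : V) : ComplexClifford Q :=
  (1 : ℂ) ⊗ₜ[ℝ] CliffordAlgebra.ι Q v

/-- Complex conjugation `ℂ → ℂ` as a real-linear map. -/
def conjLinear : ℂ →ₗ[ℝ] ℂ := Complex.conjAe.toLinearMap

/-- The antilinear anti-automorphism `Ω ↦ Ω^×` of the complexified Clifford algebra that fixes
all vectors: complex conjugation on scalars, reversal of products on the real part. -/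
def robinsonAdjoint (Q : QuadraticForm ℝ V) : ComplexClifford Q →ₗ[ℝ] ComplexClifford Q :=
  TensorProduct.map conjLinear CliffordAlgebra.reverse

/-- The antilinear anti-automorphism `Ω ↦ Ω^+` of the complexified Clifford algebra that
changes the sign of all vectors. -/
def antiRobinsonAdjoint (Q : QuadraticForm ℝ V) : ComplexClifford Q →ₗ[ℝ] ComplexClifford Q :=
  TensorProduct.map conjLinear
    (CliffordAlgebra.reverse ∘ₗ (CliffordAlgebra.involute (Q := Q)).toLinearMap)

variable {S : Type*} [AddCommGroup S] [Module ℂ S]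

/-- `B` is a non-degenerate hermitian form on `S`, antilinear in the first variable, for which
the adjoint of the action of each `Ω` is the action of `adj Ω`. -/
structure IsHermitianAdjunctionForm {Q : QuadraticForm ℝ V}
    (adj : ComplexClifford Q →ₗ[ℝ] ComplexClifford Q)
    (ρ : ComplexClifford Q ≃ₐ[ℂ] Module.End ℂ S) (B : S →ₗ⋆[ℂ] S →ₗ[ℂ] ℂ) : Prop where
  hermitian : ∀ ψ φ : S, conj (B ψ φ) = B φ ψ
  nondegenerate : B.Nondegenerate
  adjoint : ∀ (Ω : ComplexClifford Q) (ψ φ : S), B ψ (ρ Ω φ) = B (ρ (adj Ω) ψ) φ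

/-- Robinson products: `(ψ, Ω φ) = (Ω^× ψ, φ)`. -/
def IsRobinsonProduct {Q : QuadraticForm ℝ V} (ρ : ComplexClifford Q ≃ₐ[ℂ] Module.End ℂ S)
    (B : S →ₗ⋆[ℂ] S →ₗ[ℂ] ℂ) : Prop :=
  IsHermitianAdjunctionForm (robinsonAdjoint Q) ρ B

/-- Anti-Robinson products: `[ψ, Ω φ] = [Ω^+ ψ, φ]`. -/
def IsAntiRobinsonProduct {Q : QuadraticForm ℝ V} (ρ : ComplexClifford Q ≃ₐ[ℂ] Module.End ℂ S)
    (B : S →ₗ⋆[ℂ] S →ₗ[ℂ] ℂ) : Prop :=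
  IsHermitianAdjunctionForm (antiRobinsonAdjoint Q) ρ B

end Algebra

/-! ## Semi-Riemannian manifolds -/

section Manifold

/-- A smooth semi-Riemannian metric of signature `(q, p)` (`q` minus signs, `p` plus signs) on a
manifold of dimension `q + p`. -/
structure SemiRiemannianMetric (q p : ℕ) (M : Type*) [TopologicalSpace M]
    [ChartedSpace (EuclideanSpace ℝ (Fin (q + p))) M] [IsManifold (𝓡 (q + p)) ∞ M] where
  /-- The bilinear form on each tangent space. -/
  val : ∀ x : M, TangentSpace (𝓡 (q + p)) x →L[ℝ] TangentSpace (𝓡 (q + p)) x →L[ℝ] ℝ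
  symm : ∀ (x : M) (v w : TangentSpace (𝓡 (q + p)) x), val x v w = val x w v
  /-- Each tangent space has a pseudo-orthonormal basis with `q` negative and `p` positive
  vectors. -/
  signature : ∀ x : M, ∃ b : Module.Basis (Fin q ⊕ Fin p) ℝ (TangentSpace (𝓡 (q + p)) x),
    (∀ i j, i ≠ j → val x (b i) (b j) = 0) ∧
    (∀ i, val x (b (Sum.inl i)) (b (Sum.inl i)) = -1) ∧
    (∀ j, val x (b (Sum.inr j)) (b (Sum.inr j)) = 1)
  smooth : ContMDiff (𝓡 (q + p))
    ((𝓡 (q + p)).prod 𝓘(ℝ, EuclideanSpace ℝ (Fin (q + p)) →L[ℝ]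
      EuclideanSpace ℝ (Fin (q + p)) →L[ℝ] ℝ)) ∞
    (fun x ↦ TotalSpace.mk' (EuclideanSpace ℝ (Fin (q + p)) →L[ℝ]
      EuclideanSpace ℝ (Fin (q + p)) →L[ℝ] ℝ)
      (E := fun x : M ↦ TangentSpace (𝓡 (q + p)) x →L[ℝ] TangentSpace (𝓡 (q + p)) x →L[ℝ] ℝ)
      x (val x))

/-- Smoothness on the set `U` of a section of a vector bundle `V` with typical fibre `F`. -/
def SmoothSectionOn (n : ℕ) {M : Type*} [TopologicalSpace M]
    [ChartedSpace (EuclideanSpace ℝ (Fin n)) M]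
    (F : Type*) [NormedAddCommGroup F] [NormedSpace ℝ F]
    {V : M → Type*} [TopologicalSpace (TotalSpace F V)] [∀ x, TopologicalSpace (V x)]
    [FiberBundle F V] (U : Set M) (σ : ∀ x, V x) : Prop :=
  ContMDiffOn (𝓡 n) ((𝓡 n).prod 𝓘(ℝ, F)) ∞ (fun x ↦ TotalSpace.mk' F x (σ x)) U

variable {n : ℕ} {M : Type*} [TopologicalSpace M]
  [ChartedSpace (EuclideanSpace ℝ (Fin n)) M] [IsManifold (𝓡 n) ∞ M]

/-- Smoothness on `U` of a (not necessarily continuous off `U`) vector field. -/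
def SmoothVectorFieldOn (U : Set M) (X : ∀ x : M, TangentSpace (𝓡 n) x) : Prop :=
  SmoothSectionOn n (EuclideanSpace ℝ (Fin n)) U X

/-- A family of subspaces `W x` of the tangent spaces is a smooth subbundle of rank `r` if it
has, near every point, a smooth frame of `r` vector fields. -/
def IsSmoothSubbundle (r : ℕ) (W : ∀ x : M, Submodule ℝ (TangentSpace (𝓡 n) x)) : Prop :=
  ∀ x₀ : M, ∃ U : Set M, IsOpen U ∧ x₀ ∈ U ∧
    ∃ X : Fin r → ∀ x : M, TangentSpace (𝓡 n) x,
      (∀ i, SmoothVectorFieldOn U (X i)) ∧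
      ∀ x ∈ U, LinearIndependent ℝ (fun i ↦ X i x) ∧
        Submodule.span ℝ (Set.range fun i ↦ X i x) = W x

/-- A smooth subbundle `W` of the tangent bundle, of rank `r`, is orientable if there is a nowhere
vanishing smooth section `τ` of its bundle `Λ^r W^*` of forms of top degree.  Smoothness of `τ`
means that `τ(X₁, …, X_r)` is smooth on `U` for all smooth local sections `X₁, …, X_r` of `W`
on an open set `U`. -/
def IsOrientableSubbundle (r : ℕ) (W : ∀ x : M, Submodule ℝ (TangentSpace (𝓡 n) x)) : Prop :=
  IsSmoothSubbundle r W ∧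
  ∃ τ : ∀ x : M, (W x) [⋀^Fin r]→ₗ[ℝ] ℝ,
    (∀ x, τ x ≠ 0) ∧
    ∀ (U : Set M), IsOpen U → ∀ X : Fin r → ∀ x : M, W x,
      (∀ i, SmoothVectorFieldOn U (fun x ↦ (X i x : TangentSpace (𝓡 n) x))) →
      ContMDiffOn (𝓡 n) 𝓘(ℝ, ℝ) ∞ (fun x ↦ τ x (fun i ↦ X i x)) U

variable (n M) in
/-- Orientability of the manifold: there is a nowhere vanishing smooth form of top degree. -/
def IsOrientableManifold : Prop :=
  IsOrientableSubbundle (M := M) n (fun x : M ↦ (⊤ : Submodule ℝ (TangentSpace (𝓡 n) x)))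

end Manifold

section SemiRiemannian

variable {q p : ℕ} {M : Type*} [TopologicalSpace M]
  [ChartedSpace (EuclideanSpace ℝ (Fin (q + p))) M] [IsManifold (𝓡 (q + p)) ∞ M]

/-- The metric on a tangent space as a real bilinear form. -/
def SemiRiemannianMetric.bilin (g : SemiRiemannianMetric q p M) (x : M) :
    LinearMap.BilinForm ℝ (TangentSpace (𝓡 (q + p)) x) :=
  LinearMap.mk₂ ℝ (fun v w ↦ g.val x v w)
    (fun v v' w ↦ by simp) (fun c v w ↦ by simp) (fun v w w' ↦ by simp) (fun c v w ↦ by simp)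

/-- The quadratic form `v ↦ g(v, v)` on a tangent space. -/
def SemiRiemannianMetric.quad (g : SemiRiemannianMetric q p M) (x : M) :
    QuadraticForm ℝ (TangentSpace (𝓡 (q + p)) x) :=
  LinearMap.BilinMap.toQuadraticMap (g.bilin x)

/-- A splitting `TM = E₋ ⊕ E₊` of the tangent bundle into mutually orthogonal smooth subbundles,
`E₋` negative definite of rank `q` and `E₊` positive definite of rank `p`. -/
structure IsSplitting (g : SemiRiemannianMetric q p M)
    (Eneg Epos : ∀ x : M, Submodule ℝ (TangentSpace (𝓡 (q + p)) x)) : Prop where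
  neg_smooth : IsSmoothSubbundle q Eneg
  pos_smooth : IsSmoothSubbundle p Epos
  isCompl : ∀ x, IsCompl (Eneg x) (Epos x)
  orthogonal : ∀ x, ∀ v ∈ Eneg x, ∀ w ∈ Epos x, g.val x v w = 0
  neg_def : ∀ x, ∀ v ∈ Eneg x, v ≠ 0 → g.val x v v < 0
  pos_def : ∀ x, ∀ v ∈ Epos x, v ≠ 0 → 0 < g.val x v v

/-- Some splitting `TM = E₋ ⊕ E₊` has an orientable `E₋`. -/
def IsNegativeOrientable (g : SemiRiemannianMetric q p M) : Prop :=
  ∃ Eneg Epos, IsSplitting g Eneg Epos ∧ IsOrientableSubbundle q Eneg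

/-- Some splitting `TM = E₋ ⊕ E₊` has an orientable `E₊`. -/
def IsPositiveOrientable (g : SemiRiemannianMetric q p M) : Prop :=
  ∃ Eneg Epos, IsSplitting g Eneg Epos ∧ IsOrientableSubbundle p Epos

/-- Space-and-time orientability. -/
def IsSpaceTimeOrientable (g : SemiRiemannianMetric q p M) : Prop :=
  IsNegativeOrientable g ∧ IsPositiveOrientable g

variable {F : Type*} [NormedAddCommGroup F] [NormedSpace ℂ F]
  {S : M → Type*} [TopologicalSpace (TotalSpace F S)] [∀ x, TopologicalSpace (S x)]
  [∀ x, AddCommGroup (S x)] [∀ x, Module ℂ (S x)]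
  [FiberBundle F S]

variable (F S) in
/-- The structure of a spinor bundle on the complex vector bundle `S`: an isomorphism of bundles
of complex algebras from the complexified Clifford bundle of `(TM, g)` to `End S`.  It is smooth:
the Clifford product of a smooth vector field and a smooth section of `S` is smooth (on every open
set). -/
structure SpinorBundleStructure (g : SemiRiemannianMetric q p M) where
  /-- The isomorphism in the fibres over `x`. -/
  rep : ∀ x : M, ComplexClifford (g.quad x) ≃ₐ[ℂ] Module.End ℂ (S x)
  smooth : ∀ U : Set M, IsOpen U → ∀ (X : ∀ x : M, TangentSpace (𝓡 (q + p)) x) (ψ : ∀ x, S x),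
    SmoothVectorFieldOn U X → SmoothSectionOn (q + p) F U ψ →
    SmoothSectionOn (q + p) F U (fun x ↦ rep x (cliffordVector (g.quad x) (X x)) (ψ x))

variable (F) in
/-- A field of sesquilinear forms on the fibres of `S` is smooth if it sends smooth sections (on
every open set) to smooth functions. -/
def IsSmoothSesquilinearField (H : ∀ x : M, S x →ₗ⋆[ℂ] S x →ₗ[ℂ] ℂ) : Prop :=
  ∀ U : Set M, IsOpen U → ∀ ψ φ : ∀ x, S x,
    SmoothSectionOn (q + p) F U ψ → SmoothSectionOn (q + p) F U φ →
    ContMDiffOn (𝓡 (q + p)) 𝓘(ℝ, ℂ) ∞ (fun x ↦ H x (ψ x) (φ x)) U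

/-- There is a smooth, nowhere degenerate local Robinson product on the spinor bundle. -/
def HasLocalRobinsonProduct {g : SemiRiemannianMetric q p M}
    (c : SpinorBundleStructure F S g) : Prop :=
  ∃ H : ∀ x : M, S x →ₗ⋆[ℂ] S x →ₗ[ℂ] ℂ,
    IsSmoothSesquilinearField (q := q) (p := p) F H ∧ ∀ x, IsRobinsonProduct (c.rep x) (H x)

/-- There is a smooth, nowhere degenerate local anti-Robinson product on the spinor bundle. -/
def HasLocalAntiRobinsonProduct {g : SemiRiemannianMetric q p M}
    (c : SpinorBundleStructure F S g) : Prop :=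
  ∃ G : ∀ x : M, S x →ₗ⋆[ℂ] S x →ₗ[ℂ] ℂ,
    IsSmoothSesquilinearField (q := q) (p := p) F G ∧ ∀ x, IsAntiRobinsonProduct (c.rep x) (G x)

end SemiRiemannian

end SpinGeometry

end

/-!
The dependence of products on spinors on orientations comes from one fibrewise fact.  Let
`V = W ⊕ W'` be an orthogonal splitting in which the metric is `δ`-definite on `W`, of rank `r`,
and `-δ`-definite on `W'`.  Given an adapted orthonormal frame, averaging over the finite group
that the frame generates in the Clifford algebra yields a positive definite hermitian form `h` on
spinors for which the members of the frame are unitary.  A member `u` of the frame has adjoint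
`Q u • u` for `h`, where `Q u = ±1`.  Let `ω` be the Clifford product of the frame of `W`, times a
root of unity that makes it an involution.  If a sign `σ` satisfies `σ * δ = -(-1) ^ r`, then `ω`
commutes or anticommutes with `u` exactly as needed for `h(ψ, ω φ)` to be hermitian with every
vector having adjoint `σ` times itself (`isVectorAdjoint_volumeForm`).  Here `σ = 1` gives Robinson
products and `σ = -1` anti-Robinson products.  Conversely, if `H` is any non-degenerate form of
this kind, then `H(ψ, ω φ)` is a non-zero real multiple of `h` by Schur's lemma
(`IsVectorAdjoint.exists_volumeForm_eq`).

As `ω` changes its sign with the orientation of `W`, a product distinguishes an orientation of `W`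
and conversely.  To make this independent of frames, the element `ω` is replaced by the alternating
map `cliffordAlt`, and `signForm` is the form of top degree
`(v₁, …, v_r) ↦ Re H(ψ, v₁ ∧ ⋯ ∧ v_r ψ)` on `W`, up to the root of unity.  Its ray does not depend
on the spinor `ψ ≠ 0`, so that a smooth field of products gives a ray of orientation forms, hence
an orientation (`IsDefiniteSplitting.isOrientableSubbundle_of_field`).  In the other direction, the
products whose `signForm` is positive with respect to a given orientation make up a convex set in
each fibre, non-empty by the twist above, and are glued from local solutions
(`IsDefiniteSplitting.exists_field`).

The equation `σ * δ = -(-1) ^ r` reads `σ = (-1) ^ q` for the negative part and `σ = -(-1) ^ p` for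
the positive part, which is the distinction of cases by parity.  That a splitting exists at all
(`exists_isSplitting`) is needed when a product is given; it follows by gluing maximal negative
subspaces, where one is deformed into another by shrinking its component orthogonal to the other.
Both the gluing of subspaces and that of forms are instances of `exists_good_section`.

On an orientable manifold, contracting a volume form with frames of an oriented part of a
splitting, weighted by the values of its orientation form, orients the other part
(`IsDefiniteSplitting.isOrientableSubbundle_compl`), which makes negative and positive
orientability equivalent.
-/

noncomputable section

namespace SpinGeometry

/-! ### Gluing local sections by interpolation -/

section Gluing

open Filter Topology

variable {n : ℕ} {M : Type*} [TopologicalSpace M] [T2Space M] [SigmaCompactSpace M]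
  [ChartedSpace (EuclideanSpace ℝ (Fin n)) M] [IsManifold (𝓡 n) ∞ M]

/-- Sections satisfying a fibrewise constraint `P` and a local regularity condition `good` exist
globally as soon as they exist locally, provided any two points of a fibre can be joined by an
interpolation that respects `P` and `good`.  The local sections are inserted one after another,
each one cut off by a bump function; local finiteness makes the process stop near every point. -/
theorem exists_good_section {X : M → Type*} (P : ∀ x, X x → Prop)
    (interp : ∀ x, X x → X x → ℝ → X x) (good : (∀ x, X x) → M → Prop)
    (h0 : ∀ x a b, P x a → P x b → interp x a b 0 = a)
    (h1 : ∀ x a b, P x a → P x b → interp x a b 1 = b)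
    (hP : ∀ x a b t, P x a → P x b → 0 ≤ t → t ≤ 1 → P x (interp x a b t))
    (hcongr : ∀ s s' x, (∀ᶠ y in 𝓝 x, s y = s' y) → good s x → good s' x)
    (hinterp : ∀ (χ : M → ℝ) (s t : ∀ x, X x) (x : M), ContMDiff (𝓡 n) 𝓘(ℝ, ℝ) ∞ χ →
      (∀ y, χ y ∈ Set.Icc (0 : ℝ) 1) → (∀ y, P y (s y)) → (∀ y, P y (t y)) →
      good s x → good t x → good (fun y ↦ interp y (s y) (t y) (χ y)) x)
    (hloc : ∀ x₀, ∃ s : ∀ x, X x, ∀ᶠ x in 𝓝 x₀, P x (s x) ∧ good s x) :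
    ∃ s : ∀ x, X x, (∀ x, P x (s x)) ∧ ∀ x, good s x := by
  classical
  -- local sections, modified away from the base point so as to satisfy `P` everywhere
  have hpt : ∀ x, ∃ a, P x a := fun x ↦ by
    obtain ⟨s, hs⟩ := hloc x
    exact ⟨s x, hs.self_of_nhds.1⟩
  choose a₀ ha₀ using hpt
  have hloc' : ∀ x₀, ∃ s : ∀ x, X x, (∀ x, P x (s x)) ∧ ∀ᶠ x in 𝓝 x₀, good s x := fun x₀ ↦ by
    obtain ⟨s, hs⟩ := hloc x₀
    refine ⟨fun x ↦ if P x (s x) then s x else a₀ x, fun x ↦ ?_, ?_⟩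
    · dsimp only
      split_ifs with h
      exacts [h, ha₀ x]
    · filter_upwards [hs.eventually_nhds] with x hx
      refine hcongr s _ x ?_ hx.self_of_nhds.2
      filter_upwards [hx] with y hy
      rw [if_pos hy.1]
  choose L hLP hLgood using hloc'
  have hU : ∀ x ∈ (Set.univ : Set M), {y | good (L x) y} ∈ 𝓝 x := fun x _ ↦ hLgood x
  obtain ⟨ι, f, hf⟩ := SmoothBumpCovering.exists_isSubordinate (𝓡 n) isClosed_univ hU
  have hcount : Countable ι := by
    have := f.locallyFinite.countable_univ fun i ↦ ⟨f.c i, by simp⟩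
    exact Set.countable_univ_iff.mp this
  obtain ⟨e, he⟩ := exists_injective_nat ι
  let step : ℕ → (∀ x, X x) → (∀ x, X x) := fun k s ↦
    if h : ∃ i, e i = k then
      fun x ↦ interp x (s x) (L (f.c h.choose) x) (f h.choose x)
    else s
  have step_e : ∀ i s, step (e i) s = fun x ↦ interp x (s x) (L (f.c i) x) (f i x) := by
    intro i s
    have h : ∃ j, e j = e i := ⟨i, rfl⟩
    have hc : h.choose = i := he h.choose_spec
    simp only [step]
    rw [dif_pos h, hc]
  have step_not : ∀ k s, (¬ ∃ i, e i = k) → step k s = s := fun k s h ↦ by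
    simp only [step]
    rw [dif_neg h]
  let J : ℕ → ∀ x, X x := fun k ↦ Nat.rec a₀ step k
  have J_succ : ∀ k, J (k + 1) = step k (J k) := fun k ↦ rfl
  have hmem : ∀ i y, f i y ∈ Set.Icc (0 : ℝ) 1 := fun i y ↦ (f i).mem_Icc
  have JP : ∀ k x, P x (J k x) := by
    intro k
    induction k with
    | zero => exact ha₀
    | succ k ih =>
      intro x
      rw [J_succ]
      by_cases h : ∃ i, e i = k
      · obtain ⟨i, rfl⟩ := h
        rw [step_e]
        exact hP _ _ _ _ (ih x) (hLP _ x) (hmem i x).1 (hmem i x).2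
      · rw [step_not _ _ h]
        exact ih x
  -- once the bump function of index `i` has been inserted, the section is good where it equals one
  have Jgood : ∀ i x, (f i =ᶠ[𝓝 x] 1) → ∀ k, e i < k → good (J k) x := by
    intro i x hi k hk
    induction k with
    | zero => exact absurd hk (Nat.not_lt_zero _)
    | succ k ih =>
      rw [J_succ]
      have hsub : ∀ j, x ∈ tsupport (f j) → good (L (f.c j)) x := fun j hj ↦ hf j hj
      rcases Nat.lt_succ_iff_lt_or_eq.mp hk with hlt | heq
      · by_cases h : ∃ j, e j = k
        · obtain ⟨j, rfl⟩ := h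
          rw [step_e]
          by_cases hj : x ∈ tsupport (f j)
          · exact hinterp _ _ _ x (f j).contMDiff (hmem j) (JP _) (hLP _) (ih hlt) (hsub j hj)
          · refine hcongr _ _ x ?_ (ih hlt)
            filter_upwards [notMem_tsupport_iff_eventuallyEq.mp hj] with y hy
            rw [hy, Pi.zero_apply, h0 _ _ _ (JP _ y) (hLP _ y)]
        · rw [step_not _ _ h]
          exact ih hlt
      · rw [← heq, step_e]
        refine hcongr (L (f.c i)) _ x ?_ (hsub i ?_)
        · filter_upwards [hi] with y hy
          rw [hy, Pi.one_apply, h1 _ _ _ (JP _ y) (hLP _ y)]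
        · refine subset_tsupport _ ?_
          have := hi.self_of_nhds
          simp only [Function.mem_support, this, Pi.one_apply]
          exact one_ne_zero
  -- near every point the sequence `J` is eventually constant, uniformly in a neighbourhood
  have hstab : ∀ x₀, ∃ N, ∀ᶠ x in 𝓝 x₀, ∀ k, N ≤ k → J k x = J N x := by
    intro x₀
    obtain ⟨V, hV, hfin⟩ := f.locallyFinite x₀
    obtain ⟨N, hN⟩ := (hfin.image e).bddAbove
    refine ⟨N + 1, ?_⟩
    filter_upwards [hV] with x hx k hk
    induction k, hk using Nat.le_induction with
    | base => rfl
    | succ k hk ih =>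
      rw [J_succ]
      by_cases h : ∃ i, e i = k
      · obtain ⟨i, rfl⟩ := h
        have hz : f i x = 0 := by
          by_contra hne
          have : e i ≤ N := hN ⟨i, ⟨x, hne, hx⟩, rfl⟩
          omega
        rw [← ih, step_e]
        exact (congrArg _ hz).trans (h0 _ _ _ (JP _ x) (hLP _ x))
      · rw [step_not _ _ h, ih]
  choose N hN using hstab
  refine ⟨fun x ↦ J (N x) x, fun x ↦ JP _ x, fun x ↦ ?_⟩
  have hx := f.eventuallyEq_one x (Set.mem_univ x)
  set i := f.ind x (Set.mem_univ x)
  refine hcongr (J (max (N x) (e i + 1))) _ x ?_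
    (Jgood i x hx _ (lt_of_lt_of_le (Nat.lt_succ_self _) (le_max_right _ _)))
  filter_upwards [hN x] with y hy
  have hy' := (hN y).self_of_nhds
  rw [hy _ (le_max_left _ _)]
  rcases le_total (N x) (N y) with h | h
  · exact (hy _ h).symm
  · exact hy' _ h

end Gluing

/-! ### Products of anticommuting elements and the Clifford volume element -/

section AnticommutingProducts

variable {A : Type*} [Ring A] [Algebra ℝ A]

theorem mul_prod_ofFn_of_anticomm {r : ℕ} (a : A) (E : Fin r → A)
    (h : ∀ i, a * E i = -(E i * a)) :
    a * (List.ofFn E).prod = (-1 : ℝ) ^ r • ((List.ofFn E).prod * a) := by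
  induction r with
  | zero => simp
  | succ r ih =>
    rw [List.ofFn_succ, List.prod_cons, ← mul_assoc, h 0, neg_mul, mul_assoc,
      ih (fun i ↦ E i.succ) fun i ↦ h i.succ, mul_smul_comm, mul_assoc, pow_succ, mul_neg_one,
      neg_smul]

/-- A factor of a product of `r` anticommuting elements commutes with itself and anticommutes with
the other `r - 1` factors. -/
theorem apply_mul_prod_ofFn {r : ℕ} (E : Fin r → A)
    (h : ∀ i j, i ≠ j → E i * E j = -(E j * E i)) (k : Fin r) :
    E k * (List.ofFn E).prod = (-(-1 : ℝ) ^ r) • ((List.ofFn E).prod * E k) := by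
  induction r with
  | zero => exact k.elim0
  | succ r ih =>
    rw [List.ofFn_succ, List.prod_cons]
    refine Fin.cases ?_ (fun j ↦ ?_) k
    · have := mul_prod_ofFn_of_anticomm (E 0) (fun i ↦ E i.succ)
        fun i ↦ h _ _ (Fin.succ_ne_zero i).symm
      rw [pow_succ, mul_neg_one, neg_neg, mul_assoc, ← mul_smul_comm, ← this]
    · have := ih (fun i ↦ E i.succ) (fun i j hij ↦ h _ _ fun he ↦ hij (Fin.succ_injective _ he)) j
      rw [← mul_assoc, h _ _ (Fin.succ_ne_zero j), neg_mul, mul_assoc, this, mul_smul_comm,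
        mul_assoc, pow_succ, mul_neg_one, neg_neg, neg_smul, neg_neg]

/-- The sign of the square of a product of `r` anticommuting elements of square `δ`. -/
def volSign (δ : ℝ) : ℕ → ℝ
  | 0 => 1
  | r + 1 => (-1) ^ r * δ * volSign δ r

theorem volSign_eq_one_or {δ : ℝ} (hδ : δ = 1 ∨ δ = -1) (r : ℕ) :
    volSign δ r = 1 ∨ volSign δ r = -1 := by
  induction r with
  | zero => exact Or.inl rfl
  | succ r ih =>
    rw [volSign]
    rcases neg_one_pow_eq_or ℝ r with h | h <;> rcases hδ with h' | h' <;>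
      rcases ih with h'' | h'' <;> simp [h, h'] at h'' ⊢ <;> simp [h'']

theorem prod_ofFn_mul_self {r : ℕ} (δ : ℝ) (E : Fin r → A)
    (h : ∀ i j, i ≠ j → E i * E j = -(E j * E i)) (hE : ∀ i, E i * E i = δ • (1 : A)) :
    (List.ofFn E).prod * (List.ofFn E).prod = volSign δ r • (1 : A) := by
  induction r with
  | zero => simp [volSign]
  | succ r ih =>
    rw [List.ofFn_succ, List.prod_cons]
    set P := (List.ofFn fun i ↦ E i.succ).prod with hP
    have h1 : E 0 * P = (-1 : ℝ) ^ r • (P * E 0) :=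
      mul_prod_ofFn_of_anticomm (E 0) (fun i ↦ E i.succ) fun i ↦ h _ _ (Fin.succ_ne_zero i).symm
    have h2 : P * P = volSign δ r • (1 : A) :=
      ih (fun i ↦ E i.succ) (fun i j hij ↦ h _ _ fun he ↦ hij (Fin.succ_injective _ he))
        fun i ↦ hE i.succ
    have h3 : P * E 0 = (-1 : ℝ) ^ r • (E 0 * P) := by
      rw [h1, smul_smul, ← mul_pow]
      simp
    calc E 0 * P * (E 0 * P) = E 0 * (P * E 0) * P := by simp only [mul_assoc]
      _ = (-1 : ℝ) ^ r • ((E 0 * E 0) * (P * P)) := by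
        rw [h3, mul_smul_comm, smul_mul_assoc]; simp only [mul_assoc]
      _ = volSign δ (r + 1) • (1 : A) := by
        rw [h2, hE, volSign, mul_smul_comm, mul_one, smul_smul, smul_smul]
        congr 1
        ring

/-- A square root of `volSign δ r`, so that `volRoot δ r` times the product of `r` anticommuting
elements of square `δ` is an involution. -/
def volRoot (δ : ℝ) (r : ℕ) : ℂ := if volSign δ r = 1 then 1 else Complex.I

theorem volRoot_mul_self {δ : ℝ} (hδ : δ = 1 ∨ δ = -1) (r : ℕ) :
    volRoot δ r * volRoot δ r = (volSign δ r : ℂ) := by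
  unfold volRoot
  rcases volSign_eq_one_or hδ r with h | h <;> norm_num [h]

theorem conj_volRoot {δ : ℝ} (hδ : δ = 1 ∨ δ = -1) (r : ℕ) :
    conj (volRoot δ r) = (volSign δ r : ℂ) * volRoot δ r := by
  unfold volRoot
  rcases volSign_eq_one_or hδ r with h | h <;> norm_num [h]

end AnticommutingProducts

section CliffordAlt

variable {V : Type*} [AddCommGroup V] [Module ℝ V] (Q : QuadraticForm ℝ V)

open CliffordAlgebra

theorem ι_mul_ι_anticomm {u v : V} (h : QuadraticMap.polar Q u v = 0) :
    ι Q u * ι Q v = -(ι Q v * ι Q u) := by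
  rw [eq_neg_iff_add_eq_zero, ι_mul_ι_add_swap, h, map_zero]

theorem ι_mul_ι_self (u : V) : ι Q u * ι Q u = Q u • (1 : CliffordAlgebra Q) := by
  rw [ι_sq_scalar, Algebra.algebraMap_eq_smul_one]

/-- The totally antisymmetrized Clifford product of `r` vectors: the element of the Clifford
algebra that corresponds to their exterior product. -/
def cliffordAlt (r : ℕ) : V [⋀^Fin r]→ₗ[ℝ] CliffordAlgebra Q :=
  (equivExterior Q).symm.toLinearMap.compAlternatingMap (ExteriorAlgebra.ιMulti ℝ r)

theorem contractLeft_prod_ofFn_eq_zero {r : ℕ} (d : Module.Dual ℝ V) (v : Fin r → V)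
    (h : ∀ i, d (v i) = 0) : contractLeft d (List.ofFn fun i ↦ ι Q (v i)).prod = 0 := by
  induction r with
  | zero => simp
  | succ r ih =>
    rw [List.ofFn_succ, List.prod_cons, contractLeft_ι_mul, h 0,
      ih (fun i ↦ v i.succ) fun i ↦ h i.succ]
    simp

/-- On mutually orthogonal vectors the antisymmetrized Clifford product is the Clifford
product. -/
theorem cliffordAlt_of_orthogonal {r : ℕ} (v : Fin r → V)
    (h : ∀ i j, i ≠ j → QuadraticMap.polar Q (v i) (v j) = 0) :
    cliffordAlt Q r v = (List.ofFn fun i ↦ ι Q (v i)).prod := by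
  induction r with
  | zero =>
    change changeForm (changeForm.neg_proof (changeForm.associated_neg_proof (Q := Q)))
      (ExteriorAlgebra.ιMulti ℝ 0 v) = _
    rw [ExteriorAlgebra.ιMulti_zero_apply]
    simp
  | succ r ih =>
    have ih' := ih (fun i ↦ v i.succ) fun i j hij ↦ h _ _ fun he ↦ hij (Fin.succ_injective _ he)
    change changeForm (changeForm.neg_proof (changeForm.associated_neg_proof (Q := Q)))
      (ExteriorAlgebra.ιMulti ℝ r.succ v) = _
    rw [ExteriorAlgebra.ιMulti_succ_apply]
    -- the Clifford and the exterior product with `v 0` differ by a contraction with the functional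
    -- of `v 0`, which vanishes on the other vectors
    erw [changeForm_ι_mul]
    change _ * cliffordAlt Q r (fun i ↦ v i.succ) -
      contractLeft _ (cliffordAlt Q r (fun i ↦ v i.succ)) = _
    rw [ih', contractLeft_prod_ofFn_eq_zero, sub_zero, List.ofFn_succ, List.prod_cons]
    intro i
    have := h 0 i.succ (Fin.succ_ne_zero i).symm
    simp [QuadraticMap.associated_apply, QuadraticMap.polar] at this ⊢
    linarith

end CliffordAlt

/-! ### Hermitian forms on a spinor space -/

section SpinorForms

open CliffordAlgebra

variable {V : Type*} [AddCommGroup V] [Module ℝ V] {Q : QuadraticForm ℝ V}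
  {S : Type*} [AddCommGroup S] [Module ℂ S]

/-- The action on spinors of an element of the real Clifford algebra. -/
def realAction (ρ : ComplexClifford Q ≃ₐ[ℂ] Module.End ℂ S) (a : CliffordAlgebra Q) :
    Module.End ℂ S :=
  ρ ((1 : ℂ) ⊗ₜ[ℝ] a)

variable (ρ : ComplexClifford Q ≃ₐ[ℂ] Module.End ℂ S)

theorem realAction_mul (a b : CliffordAlgebra Q) :
    realAction ρ (a * b) = realAction ρ a * realAction ρ b := by
  rw [realAction, realAction, realAction, ← map_mul, Algebra.TensorProduct.tmul_mul_tmul, one_mul]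

theorem realAction_one : realAction ρ 1 = 1 := map_one ρ

theorem realAction_add (a b : CliffordAlgebra Q) :
    realAction ρ (a + b) = realAction ρ a + realAction ρ b := by
  rw [realAction, TensorProduct.tmul_add, map_add]; rfl

theorem realAction_smul (t : ℝ) (a : CliffordAlgebra Q) :
    realAction ρ (t • a) = (t : ℂ) • realAction ρ a := by
  rw [realAction, realAction, ← map_smul, ← TensorProduct.smul_tmul, TensorProduct.smul_tmul']
  simp

theorem realAction_neg (a : CliffordAlgebra Q) : realAction ρ (-a) = -realAction ρ a := by
  rw [realAction, TensorProduct.tmul_neg, map_neg]; rfl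

theorem realAction_algebraMap (t : ℝ) :
    realAction ρ (algebraMap ℝ _ t) = (t : ℂ) • (1 : Module.End ℂ S) := by
  rw [Algebra.algebraMap_eq_smul_one, realAction_smul, realAction_one]

theorem apply_tmul (z : ℂ) (a : CliffordAlgebra Q) : ρ (z ⊗ₜ[ℝ] a) = z • realAction ρ a := by
  rw [realAction, ← map_smul, TensorProduct.smul_tmul', smul_eq_mul, mul_one]

/-- A sesquilinear form is `IsVectorAdjoint` with sign `σ` if it is hermitian and every vector acts
with adjoint `σ` times itself: `σ = 1` for Robinson products, `σ = -1` for anti-Robinson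
products.  Non-degeneracy is not included. -/
structure IsVectorAdjoint (σ : ℝ) (ρ : ComplexClifford Q ≃ₐ[ℂ] Module.End ℂ S)
    (H : S →ₗ⋆[ℂ] S →ₗ[ℂ] ℂ) : Prop where
  hermitian : ∀ ψ φ : S, conj (H ψ φ) = H φ ψ
  adjoint : ∀ (u : V) (ψ φ : S),
    H ψ (realAction ρ (ι Q u) φ) = σ * H (realAction ρ (ι Q u) ψ) φ

/-- The adjoint of every element of the Clifford algebra is determined by those of the
vectors. -/
theorem IsVectorAdjoint.adjoint_all {σ : ℝ} {ρ : ComplexClifford Q ≃ₐ[ℂ] Module.End ℂ S}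
    {H : S →ₗ⋆[ℂ] S →ₗ[ℂ] ℂ} (hH : IsVectorAdjoint σ ρ H)
    (θ : CliffordAlgebra Q →ₗ[ℝ] CliffordAlgebra Q)
    (hmul : ∀ a b, θ (a * b) = θ b * θ a) (halg : ∀ t, θ (algebraMap ℝ _ t) = algebraMap ℝ _ t)
    (hι : ∀ u, θ (ι Q u) = σ • ι Q u) (Ω : ComplexClifford Q) (ψ φ : S) :
    H ψ (ρ Ω φ) = H (ρ (TensorProduct.map conjLinear θ Ω) ψ) φ := by
  have key : ∀ (a : CliffordAlgebra Q) (ψ φ : S),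
      H ψ (realAction ρ a φ) = H (realAction ρ (θ a) ψ) φ := by
    intro a
    induction a using CliffordAlgebra.induction with
    | algebraMap t => intro ψ φ; simp [halg, realAction_algebraMap, -Complex.coe_smul]
    | ι u => intro ψ φ; simp [hι, hH.adjoint, realAction_smul, -Complex.coe_smul]
    | mul a b ha hb =>
      intro ψ φ
      rw [realAction_mul, hmul, realAction_mul, Module.End.mul_apply, Module.End.mul_apply, ha, hb]
    | add a b ha hb => intro ψ φ; simp [realAction_add, ha, hb]
  induction Ω using TensorProduct.induction_on with
  | zero => simp
  | tmul z a =>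
    rw [TensorProduct.map_tmul, apply_tmul, apply_tmul]
    simp [key, conjLinear]
  | add x y hx hy => simp only [map_add, LinearMap.add_apply, hx, hy]

theorem isRobinsonProduct_iff (H : S →ₗ⋆[ℂ] S →ₗ[ℂ] ℂ) :
    IsRobinsonProduct ρ H ↔ IsVectorAdjoint 1 ρ H ∧ H.Nondegenerate := by
  constructor
  · intro h
    refine ⟨⟨h.hermitian, fun u ψ φ ↦ ?_⟩, h.nondegenerate⟩
    have := h.adjoint (cliffordVector Q u) ψ φ
    rw [robinsonAdjoint, cliffordVector, TensorProduct.map_tmul, reverse_ι] at this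
    simpa [conjLinear, realAction] using this
  · rintro ⟨h, hn⟩
    exact ⟨h.hermitian, hn, h.adjoint_all _ (fun a b ↦ reverse.map_mul a b)
      (fun t ↦ reverse.commutes t) fun u ↦ by rw [reverse_ι, one_smul]⟩

theorem isAntiRobinsonProduct_iff (H : S →ₗ⋆[ℂ] S →ₗ[ℂ] ℂ) :
    IsAntiRobinsonProduct ρ H ↔ IsVectorAdjoint (-1) ρ H ∧ H.Nondegenerate := by
  constructor
  · intro h
    refine ⟨⟨h.hermitian, fun u ψ φ ↦ ?_⟩, h.nondegenerate⟩
    have := h.adjoint (cliffordVector Q u) ψ φ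
    rw [antiRobinsonAdjoint, cliffordVector, TensorProduct.map_tmul] at this
    simpa [conjLinear, realAction, TensorProduct.tmul_neg] using this
  · rintro ⟨h, hn⟩
    exact ⟨h.hermitian, hn, h.adjoint_all _ (fun a b ↦ by simp)
      (fun t ↦ by simp) fun u ↦ by simp⟩

/-- A positive definite hermitian form. -/
structure IsPosDefForm (h : S →ₗ⋆[ℂ] S →ₗ[ℂ] ℂ) : Prop where
  hermitian : ∀ ψ φ : S, conj (h ψ φ) = h φ ψ
  pos : ∀ ψ : S, ψ ≠ 0 → 0 < (h ψ ψ).re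

/-- The sum of the transforms of a form by the products, in reverse order, of the sublists of a
list of operators.  For operators that pairwise anticommute and square to `±1` this is, up to a
factor, the average of the form over the finite group that they generate. -/
def averageForm (m : S →ₗ⋆[ℂ] S →ₗ[ℂ] ℂ) : List (Module.End ℂ S) → (S →ₗ⋆[ℂ] S →ₗ[ℂ] ℂ)
  | [] => m
  | b :: L => averageForm m L + ((averageForm m L).comp b).compl₂ b

theorem averageForm_cons_apply (m : S →ₗ⋆[ℂ] S →ₗ[ℂ] ℂ) (b : Module.End ℂ S)
    (L : List (Module.End ℂ S)) (ψ φ : S) :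
    averageForm m (b :: L) ψ φ = averageForm m L ψ φ + averageForm m L (b ψ) (b φ) := rfl

theorem isPosDefForm_averageForm {m : S →ₗ⋆[ℂ] S →ₗ[ℂ] ℂ} (hm : IsPosDefForm m)
    (L : List (Module.End ℂ S)) : IsPosDefForm (averageForm m L) := by
  induction L with
  | nil => exact hm
  | cons b L ih =>
    refine ⟨fun ψ φ ↦ ?_, fun ψ hψ ↦ ?_⟩
    · simp only [averageForm_cons_apply, map_add, ih.hermitian]
    · rw [averageForm_cons_apply, Complex.add_re]
      have h1 := ih.pos ψ hψ
      by_cases hb : b ψ = 0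
      · simpa [hb] using h1
      · exact add_pos h1 (ih.pos _ hb)

/-- Anticommuting operators of square `±1` preserve the averaged form. -/
theorem averageForm_apply_apply (m : S →ₗ⋆[ℂ] S →ₗ[ℂ] ℂ) {L : List (Module.End ℂ S)}
    (hsq : ∀ b ∈ L, b * b = 1 ∨ b * b = -1) (hac : L.Pairwise fun a b ↦ a * b = -(b * a)) :
    ∀ b ∈ L, ∀ ψ φ, averageForm m L (b ψ) (b φ) = averageForm m L ψ φ := by
  induction L with
  | nil => simp
  | cons a L ih =>
    rw [List.pairwise_cons] at hac
    have ih' := ih (fun b hb ↦ hsq b (List.mem_cons_of_mem _ hb)) hac.2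
    intro b hb ψ φ
    rw [averageForm_cons_apply, averageForm_cons_apply]
    rcases List.mem_cons.mp hb with rfl | hb
    · rw [add_comm]
      congr 1
      simp only [← Module.End.mul_apply]
      rcases hsq b List.mem_cons_self with h | h <;> simp [h]
    · rw [ih' b hb]
      congr 1
      have hc : ∀ χ, a (b χ) = -(b (a χ)) := fun χ ↦ LinearMap.congr_fun (hac.1 b hb) χ
      rw [hc, hc, map_neg, map_neg, LinearMap.neg_apply, neg_neg, ih' b hb]

/-- An orthonormal frame of a quadratic space adapted to an orthogonal splitting: the vectors `e`
have square `δ`, the vectors `f` have square `-δ`. -/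
structure IsAdaptedFrame (Q : QuadraticForm ℝ V) (δ : ℝ) {r r' : ℕ} (e : Fin r → V)
    (f : Fin r' → V) : Prop where
  orth_e : ∀ i j, i ≠ j → QuadraticMap.polar Q (e i) (e j) = 0
  orth_f : ∀ i j, i ≠ j → QuadraticMap.polar Q (f i) (f j) = 0
  orth_ef : ∀ i j, QuadraticMap.polar Q (e i) (f j) = 0
  sq_e : ∀ i, Q (e i) = δ
  sq_f : ∀ j, Q (f j) = -δ
  span : Submodule.span ℝ (Set.range e ∪ Set.range f) = ⊤

/-- The Clifford product of a family of vectors. -/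
def cliffordProd (Q : QuadraticForm ℝ V) {r : ℕ} (e : Fin r → V) : CliffordAlgebra Q :=
  (List.ofFn fun i ↦ ι Q (e i)).prod

/-- The operators by which the members of a frame act on spinors. -/
def frameOperators (ρ : ComplexClifford Q ≃ₐ[ℂ] Module.End ℂ S) {r r' : ℕ} (e : Fin r → V)
    (f : Fin r' → V) : List (Module.End ℂ S) :=
  (List.ofFn e ++ List.ofFn f).map fun u ↦ realAction ρ (ι Q u)

namespace IsAdaptedFrame

variable {δ : ℝ} {r r' : ℕ} {e : Fin r → V} {f : Fin r' → V}

theorem orth_fe (he : IsAdaptedFrame Q δ e f) (j : Fin r') (i : Fin r) :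
    QuadraticMap.polar Q (f j) (e i) = 0 := by
  rw [QuadraticMap.polar_comm]; exact he.orth_ef i j

/-- The averaged form is invariant under the members of the frame. -/
theorem averageForm_invariant (he : IsAdaptedFrame Q δ e f) (hδ : δ = 1 ∨ δ = -1)
    (m : S →ₗ⋆[ℂ] S →ₗ[ℂ] ℂ) (u : V) (hu : u ∈ Set.range e ∪ Set.range f) (ψ φ : S) :
    averageForm m (frameOperators ρ e f) (realAction ρ (ι Q u) ψ) (realAction ρ (ι Q u) φ) =
      averageForm m (frameOperators ρ e f) ψ φ := by
  refine averageForm_apply_apply m ?_ ?_ _ ?_ ψ φ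
  · intro b hb
    obtain ⟨w, hw, rfl⟩ := List.mem_map.mp hb
    have hw' : Q w = 1 ∨ Q w = -1 := by
      rcases List.mem_append.mp hw with h | h <;> obtain ⟨i, rfl⟩ := (List.mem_ofFn' _ _).mp h
      · rw [he.sq_e]; exact hδ
      · rw [he.sq_f]; rcases hδ with h | h <;> simp [h]
    rw [← realAction_mul, ι_mul_ι_self, realAction_smul, realAction_one]
    rcases hw' with h | h <;> simp [h]
  · unfold frameOperators
    rw [List.pairwise_map]
    have hR : ∀ u v : V, QuadraticMap.polar Q u v = 0 →
        realAction ρ (ι Q u) * realAction ρ (ι Q v) =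
          -(realAction ρ (ι Q v) * realAction ρ (ι Q u)) := fun u v h ↦ by
      rw [← realAction_mul, ι_mul_ι_anticomm Q h, realAction_neg, realAction_mul]
    refine List.Pairwise.imp (fun {u v} h ↦ hR u v h) ?_
    rw [List.pairwise_append]
    refine ⟨?_, ?_, ?_⟩
    · rw [List.pairwise_ofFn]
      exact fun i j hij ↦ he.orth_e i j hij.ne
    · rw [List.pairwise_ofFn]
      exact fun i j hij ↦ he.orth_f i j hij.ne
    · intro a ha b hb
      obtain ⟨i, rfl⟩ := (List.mem_ofFn' _ _).mp ha
      obtain ⟨j, rfl⟩ := (List.mem_ofFn' _ _).mp hb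
      exact he.orth_ef i j
  · refine List.mem_map_of_mem (List.mem_append.mpr ?_)
    rcases hu with h | h
    · exact Or.inl ((List.mem_ofFn' _ _).mpr h)
    · exact Or.inr ((List.mem_ofFn' _ _).mpr h)

end IsAdaptedFrame

/-- A positive definite hermitian form for which the members of an adapted frame are unitary. -/
structure IsCompatibleForm (ρ : ComplexClifford Q ≃ₐ[ℂ] Module.End ℂ S) {r r' : ℕ} (e : Fin r → V)
    (f : Fin r' → V) (h : S →ₗ⋆[ℂ] S →ₗ[ℂ] ℂ) : Prop extends IsPosDefForm h where
  unitary : ∀ u ∈ Set.range e ∪ Set.range f, ∀ ψ φ,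
    h (realAction ρ (ι Q u) ψ) (realAction ρ (ι Q u) φ) = h ψ φ

section Compatible

variable {ρ} {δ σ : ℝ} {r r' : ℕ} {e : Fin r → V} {f : Fin r' → V} {h : S →ₗ⋆[ℂ] S →ₗ[ℂ] ℂ}

theorem realAction_sq_apply (u : V) (ψ : S) :
    realAction ρ (ι Q u) (realAction ρ (ι Q u) ψ) = (Q u : ℂ) • ψ := by
  rw [← Module.End.mul_apply, ← realAction_mul, ι_mul_ι_self, realAction_smul, realAction_one]
  rfl

/-- A unitary vector of square `±1` is selfadjoint up to that sign. -/
theorem IsCompatibleForm.adjoint (hh : IsCompatibleForm ρ e f h) {u : V}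
    (hu : u ∈ Set.range e ∪ Set.range f) (hQ : Q u * Q u = 1) (ψ φ : S) :
    h (realAction ρ (ι Q u) ψ) φ = Q u * h ψ (realAction ρ (ι Q u) φ) := by
  have h1 := hh.unitary u hu ψ (realAction ρ (ι Q u) φ)
  rw [realAction_sq_apply, map_smul, smul_eq_mul] at h1
  rw [← h1, ← mul_assoc, ← Complex.ofReal_mul, hQ]
  simp

theorem sign_mul_self {δ : ℝ} (hδ : δ = 1 ∨ δ = -1) : δ * δ = 1 := by
  rcases hδ with h | h <;> simp [h]

theorem IsCompatibleForm.unitary_cliffordProd (hh : IsCompatibleForm ρ e f h) (ψ φ : S) :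
    h (realAction ρ (cliffordProd Q e) ψ) (realAction ρ (cliffordProd Q e) φ) = h ψ φ := by
  have key : ∀ (k : ℕ) (e' : Fin k → V), (∀ i, e' i ∈ Set.range e ∪ Set.range f) →
      h (realAction ρ (cliffordProd Q e') ψ) (realAction ρ (cliffordProd Q e') φ) = h ψ φ := by
    intro k
    induction k with
    | zero => intro e' _; simp [cliffordProd, realAction_one]
    | succ k ih =>
      intro e' he'
      have := ih (fun i ↦ e' i.succ) fun i ↦ he' _
      rw [cliffordProd] at this
      rw [cliffordProd, List.ofFn_succ, List.prod_cons, realAction_mul, Module.End.mul_apply,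
        Module.End.mul_apply, hh.unitary _ (he' 0), this]
  exact key r e fun i ↦ Or.inl ⟨i, rfl⟩

theorem IsAdaptedFrame.cliffordProd_mul_self (he : IsAdaptedFrame Q δ e f) :
    cliffordProd Q e * cliffordProd Q e = volSign δ r • (1 : CliffordAlgebra Q) :=
  prod_ofFn_mul_self δ _ (fun i j hij ↦ ι_mul_ι_anticomm Q (he.orth_e i j hij))
    fun i ↦ by rw [ι_mul_ι_self, he.sq_e]

theorem IsAdaptedFrame.cliffordProd_sq_apply (he : IsAdaptedFrame Q δ e f) (ψ : S) :
    realAction ρ (cliffordProd Q e) (realAction ρ (cliffordProd Q e) ψ) =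
      (volSign δ r : ℂ) • ψ := by
  rw [← Module.End.mul_apply, ← realAction_mul, he.cliffordProd_mul_self, realAction_smul,
    realAction_one]
  rfl

/-- The volume element is selfadjoint up to the sign of its square for a compatible form. -/
theorem IsCompatibleForm.adjoint_cliffordProd (hh : IsCompatibleForm ρ e f h)
    (he : IsAdaptedFrame Q δ e f) (hδ : δ = 1 ∨ δ = -1) (ψ φ : S) :
    h (realAction ρ (cliffordProd Q e) ψ) φ =
      volSign δ r * h ψ (realAction ρ (cliffordProd Q e) φ) := by
  have h1 := hh.unitary_cliffordProd ψ (realAction ρ (cliffordProd Q e) φ)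
  rw [he.cliffordProd_sq_apply, map_smul, smul_eq_mul] at h1
  rw [← h1, ← mul_assoc, ← Complex.ofReal_mul, sign_mul_self (volSign_eq_one_or hδ r)]
  simp

/-- Commutation of the volume element of the `δ`-definite part with the members of the frame.  The
sign `σ * Q u` is the discrepancy between the adjoint `Q u • u` of a member `u` for a compatible
form and the adjoint `σ • u` wanted. -/
theorem IsAdaptedFrame.ι_mul_cliffordProd (he : IsAdaptedFrame Q δ e f)
    (hσ : σ * δ = -(-1) ^ r) {u : V}
    (hu : u ∈ Set.range e ∪ Set.range f) :
    ι Q u * cliffordProd Q e = (σ * Q u) • (cliffordProd Q e * ι Q u) := by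
  rcases hu with ⟨i, rfl⟩ | ⟨j, rfl⟩
  · rw [he.sq_e, hσ]
    exact apply_mul_prod_ofFn (fun i ↦ ι Q (e i))
      (fun i j hij ↦ ι_mul_ι_anticomm Q (he.orth_e i j hij)) i
  · rw [he.sq_f, mul_neg, hσ, neg_neg]
    exact mul_prod_ofFn_of_anticomm (ι Q (f j)) (fun i ↦ ι Q (e i))
      fun i ↦ ι_mul_ι_anticomm Q (he.orth_fe j i)

theorem IsAdaptedFrame.sq_mul_sq (he : IsAdaptedFrame Q δ e f) (hδ : δ = 1 ∨ δ = -1) {u : V}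
    (hu : u ∈ Set.range e ∪ Set.range f) : Q u * Q u = 1 := by
  rcases hu with ⟨i, rfl⟩ | ⟨j, rfl⟩
  · rw [he.sq_e, sign_mul_self hδ]
  · rw [he.sq_f, neg_mul_neg, sign_mul_self hδ]

/-- The adjunction holds for all vectors if it holds for the members of a spanning set. -/
theorem adjoint_of_span {H : S →ₗ⋆[ℂ] S →ₗ[ℂ] ℂ} {s : Set V} (hs : Submodule.span ℝ s = ⊤)
    (hH : ∀ u ∈ s, ∀ ψ φ : S, H ψ (realAction ρ (ι Q u) φ) = σ * H (realAction ρ (ι Q u) ψ) φ)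
    (u : V) (ψ φ : S) : H ψ (realAction ρ (ι Q u) φ) = σ * H (realAction ρ (ι Q u) ψ) φ := by
  have hu : u ∈ Submodule.span ℝ s := by rw [hs]; trivial
  induction hu using Submodule.span_induction with
  | mem u hu => exact hH u hu ψ φ
  | zero => simp [realAction, TensorProduct.tmul_zero]
  | add a b _ _ ha hb => simp [realAction_add, ha, hb, mul_add]
  | smul t a _ ha => simp [realAction_smul, ha, -Complex.coe_smul]; ring

/-- The form `t * h(ψ, c ω φ)`, where `ω` is the volume element of the frame `e` and `c` the
normalizing factor `volRoot δ r`. -/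
def volumeForm (ρ : ComplexClifford Q ≃ₐ[ℂ] Module.End ℂ S) (δ : ℝ) {r : ℕ} (e : Fin r → V)
    (h : S →ₗ⋆[ℂ] S →ₗ[ℂ] ℂ) (t : ℝ) : S →ₗ⋆[ℂ] S →ₗ[ℂ] ℂ :=
  h.compl₂ ((t * volRoot δ r) • realAction ρ (cliffordProd Q e))

theorem volumeForm_apply (t : ℝ) (ψ φ : S) :
    volumeForm ρ δ e h t ψ φ =
      t * volRoot δ r * h ψ (realAction ρ (cliffordProd Q e) φ) := by
  simp [volumeForm]

/-- Twisting a compatible positive form by the normalized volume element turns the frame-dependent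
signs of the adjoints of vectors into the uniform sign `σ`. -/
theorem isVectorAdjoint_volumeForm (hh : IsCompatibleForm ρ e f h) (he : IsAdaptedFrame Q δ e f)
    (hδ : δ = 1 ∨ δ = -1) (hσ2 : σ = 1 ∨ σ = -1) (hσ : σ * δ = -(-1) ^ r) (t : ℝ) :
    IsVectorAdjoint σ ρ (volumeForm ρ δ e h t) := by
  refine ⟨fun ψ φ ↦ ?_, adjoint_of_span he.span fun u hu ψ φ ↦ ?_⟩
  · rw [volumeForm_apply, volumeForm_apply, map_mul, map_mul, hh.hermitian,
      hh.adjoint_cliffordProd he hδ, conj_volRoot hδ, Complex.conj_ofReal]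
    have : ((volSign δ r : ℝ) : ℂ) * volSign δ r = 1 := by
      rw [← Complex.ofReal_mul, sign_mul_self (volSign_eq_one_or hδ r), Complex.ofReal_one]
    linear_combination (t * volRoot δ r * h φ (realAction ρ (cliffordProd Q e) ψ)) * this
  · have hQ := he.sq_mul_sq hδ hu
    have hcomm : realAction ρ (cliffordProd Q e) (realAction ρ (ι Q u) φ) =
        ((σ * Q u : ℝ) : ℂ) • realAction ρ (ι Q u) (realAction ρ (cliffordProd Q e) φ) := by
      have h1 := he.ι_mul_cliffordProd hσ hu
      have h2 : cliffordProd Q e * ι Q u = (σ * Q u) • (ι Q u * cliffordProd Q e) := by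
        rw [h1, smul_smul]
        have : σ * Q u * (σ * Q u) = 1 := by
          linear_combination (σ * σ) * hQ + sign_mul_self hσ2
        rw [this, one_smul]
      rw [← Module.End.mul_apply, ← realAction_mul, h2, realAction_smul, realAction_mul]
      rfl
    rw [volumeForm_apply, volumeForm_apply, hcomm, map_smul, smul_eq_mul,
      hh.adjoint hu hQ, Complex.ofReal_mul]
    ring

/-- The normalized volume element is an involution, so that applying it again undoes the twist. -/
theorem volumeForm_involution (he : IsAdaptedFrame Q δ e f) (hδ : δ = 1 ∨ δ = -1) (t : ℝ)
    (ψ φ : S) :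
    volumeForm ρ δ e h t ψ (volRoot δ r • realAction ρ (cliffordProd Q e) φ) = t * h ψ φ := by
  rw [volumeForm_apply, map_smul, he.cliffordProd_sq_apply, map_smul, map_smul, smul_eq_mul,
    smul_eq_mul]
  have h1 := volRoot_mul_self hδ r
  have : ((volSign δ r : ℝ) : ℂ) * volSign δ r = 1 := by
    rw [← Complex.ofReal_mul, sign_mul_self (volSign_eq_one_or hδ r), Complex.ofReal_one]
  linear_combination (t * volSign δ r * h ψ φ) * h1 + (t * h ψ φ) * this

/-- A positive definite hermitian form on a finite-dimensional space identifies any other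
sesquilinear form with an operator. -/
theorem IsPosDefForm.exists_operator [FiniteDimensional ℂ S] (hh : IsPosDefForm h)
    (H : S →ₗ⋆[ℂ] S →ₗ[ℂ] ℂ) : ∃ K : Module.End ℂ S, ∀ ψ φ, h (K ψ) φ = H ψ φ := by
  have hinj : Function.Injective h := by
    refine (injective_iff_map_eq_zero h).mpr fun ψ hψ ↦ ?_
    by_contra hne
    have := hh.pos ψ hne
    simp [hψ] at this
  let hR : S →ₗ[ℝ] (S →ₗ[ℂ] ℂ) :=
    { toFun := h
      map_add' := map_add h
      map_smul' := fun t ψ ↦ by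
        rw [← Complex.coe_smul, map_smulₛₗ, Complex.conj_ofReal, Complex.coe_smul]; rfl }
  have hdim : Module.finrank ℝ S = Module.finrank ℝ (S →ₗ[ℂ] ℂ) := by
    rw [finrank_real_of_complex, finrank_real_of_complex]
    exact congrArg _ (Subspace.dual_finrank_eq (K := ℂ) (V := S)).symm
  have : FiniteDimensional ℝ S := FiniteDimensional.complexToReal S
  have : FiniteDimensional ℝ (S →ₗ[ℂ] ℂ) := FiniteDimensional.complexToReal _
  have hsurj : Function.Surjective hR :=
    (LinearMap.injective_iff_surjective_of_finrank_eq_finrank hdim).mp hinj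
  choose K hK using fun ψ ↦ hsurj (H ψ)
  have hK' : ∀ ψ, h (K ψ) = H ψ := hK
  refine ⟨⟨⟨K, fun ψ φ ↦ hinj ?_⟩, fun z ψ ↦ hinj ?_⟩, fun ψ φ ↦ LinearMap.congr_fun (hK' ψ) φ⟩
  · simp only [hK', map_add]
  · simp only [hK', map_smulₛₗ, RingHom.id_apply]

/-- An operator that commutes with a spanning set of vectors is central, since the Clifford algebra
acts by all operators. -/
theorem commute_realAction_of_span {s : Set V} (hs : Submodule.span ℝ s = ⊤)
    {K : Module.End ℂ S}
    (hK : ∀ u ∈ s, ∀ ψ, K (realAction ρ (ι Q u) ψ) = realAction ρ (ι Q u) (K ψ))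
    (T : Module.End ℂ S) : K * T = T * K := by
  have hV : ∀ u ψ, K (realAction ρ (ι Q u) ψ) = realAction ρ (ι Q u) (K ψ) := by
    intro u ψ
    have hu : u ∈ Submodule.span ℝ s := by rw [hs]; trivial
    induction hu using Submodule.span_induction with
    | mem u hu => exact hK u hu ψ
    | zero => simp [realAction, TensorProduct.tmul_zero]
    | add a b _ _ ha hb => simp [realAction_add, ha, hb]
    | smul t a _ ha => simp [realAction_smul, ha, -Complex.coe_smul]
  have hC : ∀ (a : CliffordAlgebra Q) ψ, K (realAction ρ a ψ) = realAction ρ a (K ψ) := by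
    intro a
    induction a using CliffordAlgebra.induction with
    | algebraMap t => intro ψ; simp [realAction_algebraMap, -Complex.coe_smul]
    | ι u => exact hV u
    | mul a b ha hb =>
      intro ψ
      rw [realAction_mul, Module.End.mul_apply, Module.End.mul_apply, ha, hb]
    | add a b ha hb => intro ψ; simp [realAction_add, ha, hb]
  obtain ⟨Ω, rfl⟩ := ρ.surjective T
  ext ψ
  rw [Module.End.mul_apply, Module.End.mul_apply]
  induction Ω using TensorProduct.induction_on with
  | zero => simp
  | tmul z a => rw [apply_tmul]; simp [hC]
  | add x y hx hy => simp only [map_add, LinearMap.add_apply, hx, hy]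

/-- Schur's lemma for adjunction forms: twisting a vector-adjoint form by the normalized volume
element gives a real multiple of any compatible positive definite form. -/
theorem IsVectorAdjoint.exists_volumeForm_eq [FiniteDimensional ℂ S] [Nontrivial S]
    {H : S →ₗ⋆[ℂ] S →ₗ[ℂ] ℂ} (hH : IsVectorAdjoint σ ρ H) (hn : H.Nondegenerate)
    (hh : IsCompatibleForm ρ e f h) (he : IsAdaptedFrame Q δ e f)
    (hδ : δ = 1 ∨ δ = -1) (hσ2 : σ = 1 ∨ σ = -1) (hσ : σ * δ = -(-1) ^ r) :
    ∃ t : ℝ, t ≠ 0 ∧ ∀ ψ φ, volumeForm ρ δ e H 1 ψ φ = t * h ψ φ := by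
  obtain ⟨K, hK⟩ := hh.toIsPosDefForm.exists_operator (volumeForm ρ δ e H 1)
  have hinj : ∀ ψ ψ', (∀ φ, h ψ φ = h ψ' φ) → ψ = ψ' := fun ψ ψ' hψ ↦ by
    by_contra hne
    have := hh.pos _ (sub_ne_zero.mpr hne)
    rw [map_sub h, LinearMap.sub_apply, hψ, sub_self] at this
    simp at this
  have hcomm : ∀ u ∈ Set.range e ∪ Set.range f, ∀ ψ,
      K (realAction ρ (ι Q u) ψ) = realAction ρ (ι Q u) (K ψ) := by
    intro u hu ψ
    refine hinj _ _ fun φ ↦ ?_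
    have hQ := he.sq_mul_sq hδ hu
    have h1 : realAction ρ (ι Q u) (realAction ρ (cliffordProd Q e) φ) =
        ((σ * Q u : ℝ) : ℂ) • realAction ρ (cliffordProd Q e) (realAction ρ (ι Q u) φ) := by
      rw [← Module.End.mul_apply, ← realAction_mul, he.ι_mul_cliffordProd hσ hu, realAction_smul,
        realAction_mul]
      rfl
    have h2 : H (realAction ρ (ι Q u) ψ) (realAction ρ (cliffordProd Q e) φ) =
        Q u * H ψ (realAction ρ (cliffordProd Q e) (realAction ρ (ι Q u) φ)) := by
      have h3 := hH.adjoint u ψ (realAction ρ (cliffordProd Q e) φ)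
      rw [h1, map_smul, smul_eq_mul, Complex.ofReal_mul] at h3
      have h4 : (σ : ℂ) * σ = 1 := by rw [← Complex.ofReal_mul, sign_mul_self hσ2]; simp
      linear_combination (-(σ : ℂ)) * h3 + (Q u * H ψ (realAction ρ (cliffordProd Q e)
        (realAction ρ (ι Q u) φ)) - H (realAction ρ (ι Q u) ψ)
        (realAction ρ (cliffordProd Q e) φ)) * h4
    rw [hK, hh.adjoint hu hQ, hK, volumeForm_apply, volumeForm_apply, h2]
    ring
  obtain ⟨z, hz⟩ : ∃ z : ℂ, ∀ ψ, K ψ = z • ψ := by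
    have : K ∈ Subalgebra.center ℂ (Module.End ℂ S) := by
      rw [Subalgebra.mem_center_iff]
      exact fun T ↦ (commute_realAction_of_span he.span hcomm T).symm
    obtain ⟨z, _, hz⟩ := Module.End.mem_subalgebraCenter_iff.mp this
    exact ⟨z, fun ψ ↦ by rw [hz]; rfl⟩
  have hval : ∀ ψ φ, volumeForm ρ δ e H 1 ψ φ = conj z * h ψ φ := fun ψ φ ↦ by
    rw [← hK, hz, map_smulₛₗ, LinearMap.smul_apply, smul_eq_mul]
  obtain ⟨ψ₀, hψ₀⟩ := exists_ne (0 : S)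
  have ha := hh.pos ψ₀ hψ₀
  have ha0 : h ψ₀ ψ₀ ≠ 0 := fun h0 ↦ by simp [h0] at ha
  -- reality of the scalar: `H` and the twist of `h` are both hermitian
  have hX := isVectorAdjoint_volumeForm hh he hδ hσ2 hσ 1
  have hHX : ∀ ψ φ, H ψ φ = conj z * volumeForm ρ δ e h 1 ψ φ := fun ψ φ ↦ by
    have h1 := volumeForm_involution (ρ := ρ) (h := H) he hδ 1 ψ φ
    rw [hval, map_smul, smul_eq_mul, Complex.ofReal_one, one_mul] at h1
    rw [← h1, volumeForm_apply, Complex.ofReal_one, one_mul]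
  have hzr : conj (conj z) = conj z := by
    set χ := volRoot δ r • realAction ρ (cliffordProd Q e) ψ₀
    have h1 : volumeForm ρ δ e h 1 ψ₀ χ = h ψ₀ ψ₀ := by
      rw [volumeForm_involution he hδ, Complex.ofReal_one, one_mul]
    have h2 := hH.hermitian χ ψ₀
    rw [hHX, hHX, map_mul, hX.hermitian, h1] at h2
    exact mul_right_cancel₀ ha0 h2
  obtain ⟨t, ht⟩ := Complex.conj_eq_iff_real.mp hzr
  refine ⟨t, fun ht0 ↦ hψ₀ (hn.1 ψ₀ fun φ ↦ ?_), fun ψ φ ↦ by rw [hval, ht]⟩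
  rw [hHX, ht, ht0]
  simp

end Compatible

end SpinorForms

/-! ### Smooth vector fields and orthonormal frames -/

section VectorFields

variable {n : ℕ} {M : Type*} [TopologicalSpace M]
  [ChartedSpace (EuclideanSpace ℝ (Fin n)) M] [IsManifold (𝓡 n) ∞ M]
  {U : Set M} {X Y : ∀ x : M, TangentSpace (𝓡 n) x}

theorem SmoothVectorFieldOn.mono {V : Set M} (hX : SmoothVectorFieldOn U X) (h : V ⊆ U) :
    SmoothVectorFieldOn V X :=
  ContMDiffOn.mono hX h

theorem SmoothVectorFieldOn.congr (hX : SmoothVectorFieldOn U X) (h : ∀ x ∈ U, Y x = X x) :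
    SmoothVectorFieldOn U Y :=
  ContMDiffOn.congr hX fun x hx ↦ by rw [h x hx]

theorem SmoothVectorFieldOn.add (hX : SmoothVectorFieldOn U X) (hY : SmoothVectorFieldOn U Y) :
    SmoothVectorFieldOn U fun x ↦ X x + Y x :=
  ContMDiffOn.add_section hX hY

theorem SmoothVectorFieldOn.sub (hX : SmoothVectorFieldOn U X) (hY : SmoothVectorFieldOn U Y) :
    SmoothVectorFieldOn U fun x ↦ X x - Y x :=
  ContMDiffOn.sub_section hX hY

theorem SmoothVectorFieldOn.smul {f : M → ℝ} (hf : ContMDiffOn (𝓡 n) 𝓘(ℝ, ℝ) ∞ f U)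
    (hX : SmoothVectorFieldOn U X) : SmoothVectorFieldOn U fun x ↦ f x • X x :=
  ContMDiffOn.smul_section hf hX

theorem SmoothVectorFieldOn.sum {ι : Type*} {s : Finset ι}
    {X : ι → ∀ x : M, TangentSpace (𝓡 n) x} (hX : ∀ i ∈ s, SmoothVectorFieldOn U (X i)) :
    SmoothVectorFieldOn U fun x ↦ ∑ i ∈ s, X i x :=
  ContMDiffOn.sum_section hX

/-- The tangent vectors at a point extend to smooth vector fields on a common neighbourhood. -/
theorem exists_smoothVectorFieldOn_eq (x₀ : M) :
    ∃ U : Set M, IsOpen U ∧ x₀ ∈ U ∧ ∀ v : TangentSpace (𝓡 n) x₀,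
      ∃ X : ∀ x : M, TangentSpace (𝓡 n) x, SmoothVectorFieldOn U X ∧ X x₀ = v := by
  set t := trivializationAt (EuclideanSpace ℝ (Fin n)) (TangentSpace (𝓡 n) : M → Type _) x₀
  have hx₀ : x₀ ∈ t.baseSet := FiberBundle.mem_baseSet_trivializationAt' x₀
  refine ⟨t.baseSet, t.open_baseSet, hx₀, fun v ↦ ⟨fun x ↦ t.symm x (t ⟨x₀, v⟩).2, ?_, ?_⟩⟩
  · refine (t.contMDiffOn_section_baseSet_iff).mpr ?_
    refine (contMDiffOn_const (c := (t ⟨x₀, v⟩).2)).congr fun x hx ↦ ?_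
    rw [t.apply_mk_symm hx]
  · exact t.symm_apply_apply_mk hx₀ v

end VectorFields

section Frames

variable {q p : ℕ} {M : Type*} [TopologicalSpace M]
  [ChartedSpace (EuclideanSpace ℝ (Fin (q + p))) M] [IsManifold (𝓡 (q + p)) ∞ M]
  (g : SemiRiemannianMetric q p M)

theorem SemiRiemannianMetric.contMDiffOn_val {U : Set M}
    {X Y : ∀ x : M, TangentSpace (𝓡 (q + p)) x} (hX : SmoothVectorFieldOn U X)
    (hY : SmoothVectorFieldOn U Y) :
    ContMDiffOn (𝓡 (q + p)) 𝓘(ℝ, ℝ) ∞ (fun x ↦ g.val x (X x) (Y x)) U := by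
  have h : ContMDiffOn (𝓡 (q + p)) ((𝓡 (q + p)).prod 𝓘(ℝ, ℝ)) ∞
      (fun x ↦ TotalSpace.mk' ℝ (E := fun _ : M ↦ ℝ) x (g.val x (X x) (Y x))) U :=
    ContMDiffOn.clm_bundle_apply₂ (F₁ := EuclideanSpace ℝ (Fin (q + p)))
      (F₂ := EuclideanSpace ℝ (Fin (q + p))) (F₃ := ℝ) (E₃ := fun _ : M ↦ ℝ)
      g.smooth.contMDiffOn hX hY
  intro x hx
  have := (contMDiffWithinAt_totalSpace.mp (h x hx)).2
  simpa using this

theorem contMDiffOn_inv_sqrt {n : ℕ} {M : Type*} [TopologicalSpace M]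
    [ChartedSpace (EuclideanSpace ℝ (Fin n)) M] {U : Set M} {f : M → ℝ}
    (hf : ContMDiffOn (𝓡 n) 𝓘(ℝ, ℝ) ∞ f U) (hpos : ∀ x ∈ U, 0 < f x) :
    ContMDiffOn (𝓡 n) 𝓘(ℝ, ℝ) ∞ (fun x ↦ (√(f x))⁻¹) U := by
  intro x hx
  have h1 : ContDiffAt ℝ ∞ (fun t : ℝ ↦ (√t)⁻¹) (f x) :=
    (Real.contDiffAt_sqrt (hpos x hx).ne').inv (Real.sqrt_ne_zero'.mpr (hpos x hx))
  exact h1.contMDiffAt.comp_contMDiffWithinAt x (hf x hx)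

/-- Gram-Schmidt orthonormalization: smooth vector fields that are linearly independent and span a
`δ`-definite subspace at a point can be orthonormalized near that point, within their span. -/
theorem exists_orthonormal_frame {δ : ℝ} (hδ : δ = 1 ∨ δ = -1) {ι : Type*} [Fintype ι]
    {U : Set M} (hU : IsOpen U) {x₀ : M} (hx₀ : x₀ ∈ U)
    (v : ι → ∀ x : M, TangentSpace (𝓡 (q + p)) x) (hv : ∀ i, SmoothVectorFieldOn U (v i))
    (hli : LinearIndependent ℝ fun i ↦ v i x₀)
    (hdef : ∀ u ∈ Submodule.span ℝ (Set.range fun i ↦ v i x₀), u ≠ 0 → 0 < δ * g.val x₀ u u) :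
    ∃ U' ⊆ U, IsOpen U' ∧ x₀ ∈ U' ∧ ∃ e : ι → ∀ x : M, TangentSpace (𝓡 (q + p)) x,
      (∀ i, SmoothVectorFieldOn U' (e i)) ∧
      ∀ x ∈ U', (∀ i, e i x ∈ Submodule.span ℝ (Set.range fun i ↦ v i x)) ∧
        (∀ i, g.val x (e i x) (e i x) = δ) ∧ ∀ i j, i ≠ j → g.val x (e i x) (e j x) = 0 := by
  classical
  have hδ2 := sign_mul_self hδ
  have main : ∀ s : Finset ι, ∃ U' ⊆ U, IsOpen U' ∧ x₀ ∈ U' ∧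
      ∃ e : ι → ∀ x : M, TangentSpace (𝓡 (q + p)) x,
      (∀ i ∈ s, SmoothVectorFieldOn U' (e i)) ∧
      ∀ x ∈ U', (∀ i ∈ s, e i x ∈ Submodule.span ℝ ((fun i ↦ v i x) '' s)) ∧
        (∀ i ∈ s, g.val x (e i x) (e i x) = δ) ∧
        ∀ i ∈ s, ∀ j ∈ s, i ≠ j → g.val x (e i x) (e j x) = 0 := by
    intro s
    induction s using Finset.induction_on with
    | empty => exact ⟨U, subset_rfl, hU, hx₀, v, by simp, by simp⟩
    | insert a s ha ih =>
      obtain ⟨U', hU'U, hU', hx₀', e, hes, he⟩ := ih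
      -- the part of `v a` orthogonal to the vectors obtained so far; `δ` is the inverse of their
      -- square
      set w : ∀ x : M, TangentSpace (𝓡 (q + p)) x :=
        fun x ↦ v a x - ∑ i ∈ s, (δ * g.val x (v a x) (e i x)) • e i x with hw
      have hwU : SmoothVectorFieldOn U' w :=
        ((hv a).mono hU'U).sub (SmoothVectorFieldOn.sum fun i hi ↦
          SmoothVectorFieldOn.smul
            (contMDiffOn_const.mul (g.contMDiffOn_val ((hv a).mono hU'U) (hes i hi))) (hes i hi))
      have hNU := contMDiffOn_const (c := δ) |>.mul (g.contMDiffOn_val hwU hwU)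
      have hsum : ∀ x ∈ U', ∑ i ∈ s, (δ * g.val x (v a x) (e i x)) • e i x ∈
          Submodule.span ℝ ((fun i ↦ v i x) '' s) := fun x hx ↦
        Submodule.sum_mem _ fun i hi ↦ Submodule.smul_mem _ _ ((he x hx).1 i hi)
      have hmono : ∀ x, Submodule.span ℝ ((fun i ↦ v i x) '' s) ≤
          Submodule.span ℝ ((fun i ↦ v i x) '' (insert a s : Finset ι)) := fun x ↦
        Submodule.span_mono (Set.image_mono (by simp))
      have hwspan : ∀ x ∈ U', w x ∈
          Submodule.span ℝ ((fun i ↦ v i x) '' (insert a s : Finset ι)) := fun x hx ↦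
        Submodule.sub_mem _ (Submodule.subset_span ⟨a, by simp, rfl⟩) (hmono x (hsum x hx))
      have hw0 : w x₀ ≠ 0 := fun h0 ↦ by
        have h1 : v a x₀ ∈ Submodule.span ℝ ((fun i ↦ v i x₀) '' s) := by
          have := hsum x₀ hx₀'
          rwa [← sub_eq_zero.mp h0] at this
        exact hli.notMem_span_image (by simpa using ha) h1
      have hN0 : 0 < δ * g.val x₀ (w x₀) (w x₀) :=
        hdef _ (Submodule.span_mono (Set.image_subset_range _ _) (hwspan x₀ hx₀')) hw0
      have hwe : ∀ x ∈ U', ∀ j ∈ s, g.val x (w x) (e j x) = 0 := by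
        intro x hx j hj
        obtain ⟨-, h1, h2⟩ := he x hx
        have h3 : ∑ i ∈ s, (δ * g.val x (v a x) (e i x)) * g.val x (e i x) (e j x) =
            (δ * g.val x (v a x) (e j x)) * g.val x (e j x) (e j x) :=
          Finset.sum_eq_single j (fun i hi hij ↦ by rw [h2 i hi j hj hij, mul_zero])
            fun h ↦ absurd hj h
        simp only [hw, map_sub, map_sum, map_smul, _root_.sub_apply,
          _root_.sum_apply, _root_.smul_apply, smul_eq_mul]
        rw [h3, h1 j hj]
        linear_combination (-(g.val x (v a x) (e j x))) * hδ2
      refine ⟨U' ∩ {x | 0 < δ * g.val x (w x) (w x)}, fun x hx ↦ hU'U hx.1,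
        hNU.continuousOn.isOpen_inter_preimage hU' isOpen_Ioi, ⟨hx₀', hN0⟩,
        Function.update e a fun x ↦ (√(δ * g.val x (w x) (w x)))⁻¹ • w x, ?_, ?_⟩
      · intro i hi
        by_cases hia : i = a
        · subst hia
          rw [Function.update_self]
          exact SmoothVectorFieldOn.smul
            (contMDiffOn_inv_sqrt (hNU.mono Set.inter_subset_left) fun x hx ↦ hx.2)
            (hwU.mono Set.inter_subset_left)
        · rw [Function.update_of_ne hia]
          exact (hes i (Finset.mem_of_mem_insert_of_ne hi hia)).mono Set.inter_subset_left
      · rintro x ⟨hx, hxN⟩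
        have hxN' : 0 < δ * g.val x (w x) (w x) := hxN
        obtain ⟨h1, h2, h3⟩ := he x hx
        refine ⟨fun i hi ↦ ?_, fun i hi ↦ ?_, fun i hi j hj hij ↦ ?_⟩
        · by_cases hia : i = a
          · subst hia
            rw [Function.update_self]
            exact Submodule.smul_mem _ _ (hwspan x hx)
          · rw [Function.update_of_ne hia]
            exact hmono x (h1 i (Finset.mem_of_mem_insert_of_ne hi hia))
        · by_cases hia : i = a
          · subst hia
            rw [Function.update_self]
            simp only [map_smul, _root_.smul_apply, smul_eq_mul]
            have hs := Real.mul_self_sqrt hxN'.le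
            have hs0 : √(δ * g.val x (w x) (w x)) ≠ 0 := Real.sqrt_ne_zero'.mpr hxN'
            field_simp
            rw [pow_two, hs]
            linear_combination (-(g.val x (w x) (w x))) * hδ2
          · rw [Function.update_of_ne hia]
            exact h2 i (Finset.mem_of_mem_insert_of_ne hi hia)
        · by_cases hia : i = a
          · subst hia
            rw [Function.update_self, Function.update_of_ne (Ne.symm hij)]
            simp only [map_smul, _root_.smul_apply, smul_eq_mul]
            rw [hwe x hx j (Finset.mem_of_mem_insert_of_ne hj (Ne.symm hij)), mul_zero]
          · by_cases hja : j = a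
            · subst hja
              rw [Function.update_self, Function.update_of_ne hia, g.symm]
              simp only [map_smul, _root_.smul_apply, smul_eq_mul]
              rw [hwe x hx i (Finset.mem_of_mem_insert_of_ne hi hia), mul_zero]
            · rw [Function.update_of_ne hia, Function.update_of_ne hja]
              exact h3 i (Finset.mem_of_mem_insert_of_ne hi hia) j
                (Finset.mem_of_mem_insert_of_ne hj hja) hij
  obtain ⟨U', h1, h2, h3, e, h4, h5⟩ := main Finset.univ
  refine ⟨U', h1, h2, h3, e, fun i ↦ h4 i (Finset.mem_univ i), fun x hx ↦ ?_⟩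
  obtain ⟨h6, h7, h8⟩ := h5 x hx
  refine ⟨fun i ↦ ?_, fun i ↦ h7 i (Finset.mem_univ i),
    fun i j ↦ h8 i (Finset.mem_univ i) j (Finset.mem_univ j)⟩
  simpa using h6 i (Finset.mem_univ i)

end Frames

/-! ### Definite subspaces of an indefinite bilinear form -/

section Bilinear

variable {V : Type*} [AddCommGroup V] [Module ℝ V] {B : LinearMap.BilinForm ℝ V}

/-- A family of mutually orthogonal vectors of square `δ`. -/
def IsOrthonormalFamily (B : LinearMap.BilinForm ℝ V) (δ : ℝ) {ι : Type*} (e : ι → V) : Prop :=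
  (∀ i, B (e i) (e i) = δ) ∧ ∀ i j, i ≠ j → B (e i) (e j) = 0

namespace IsOrthonormalFamily

variable {δ : ℝ} {ι : Type*} [Fintype ι] {e : ι → V}

theorem sum_apply (he : IsOrthonormalFamily B δ e) (c : ι → ℝ) (j : ι) :
    B (∑ i, c i • e i) (e j) = c j * δ := by
  simp only [map_sum, map_smul, LinearMap.sum_apply, LinearMap.smul_apply, smul_eq_mul]
  rw [Finset.sum_eq_single j (fun i _ hij ↦ by rw [he.2 i j hij, mul_zero])
    fun h ↦ absurd (Finset.mem_univ j) h, he.1]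

theorem linearIndependent (he : IsOrthonormalFamily B δ e) (hδ : δ = 1 ∨ δ = -1) :
    LinearIndependent ℝ e := by
  rw [Fintype.linearIndependent_iff]
  intro c hc j
  have h := he.sum_apply c j
  rw [hc, map_zero, LinearMap.zero_apply] at h
  have := sign_mul_self hδ
  linear_combination (-δ) * h - (c j) * this

theorem eq_sum_of_mem_span (he : IsOrthonormalFamily B δ e) (hδ : δ = 1 ∨ δ = -1) {u : V}
    (hu : u ∈ Submodule.span ℝ (Set.range e)) : u = ∑ i, (δ * B u (e i)) • e i := by
  obtain ⟨c, rfl⟩ := Submodule.mem_span_range_iff_exists_fun ℝ |>.mp hu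
  refine Finset.sum_congr rfl fun i _ ↦ ?_
  rw [he.sum_apply]
  congr 1
  linear_combination (-(c i)) * sign_mul_self hδ

theorem definite (he : IsOrthonormalFamily B δ e) (hδ : δ = 1 ∨ δ = -1) {u : V}
    (hu : u ∈ Submodule.span ℝ (Set.range e)) (hu0 : u ≠ 0) : 0 < δ * B u u := by
  obtain ⟨c, rfl⟩ := Submodule.mem_span_range_iff_exists_fun ℝ |>.mp hu
  have h : δ * B (∑ i, c i • e i) (∑ i, c i • e i) = ∑ i, c i * c i := by
    rw [map_sum (B (∑ i, c i • e i)), Finset.mul_sum]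
    refine Finset.sum_congr rfl fun j _ ↦ ?_
    rw [map_smul, he.sum_apply, smul_eq_mul]
    linear_combination (c j * c j) * sign_mul_self hδ
  rw [h]
  refine (Finset.sum_nonneg fun i _ ↦ mul_self_nonneg _).lt_of_ne' fun h0 ↦ hu0 ?_
  rw [Finset.sum_eq_zero_iff_of_nonneg fun i _ ↦ mul_self_nonneg _] at h0
  exact Finset.sum_eq_zero fun i hi ↦ by rw [mul_self_eq_zero.mp (h0 i hi), zero_smul]

theorem finrank_span (he : IsOrthonormalFamily B δ e) (hδ : δ = 1 ∨ δ = -1) :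
    Module.finrank ℝ (Submodule.span ℝ (Set.range e)) = Fintype.card ι :=
  finrank_span_eq_card (he.linearIndependent hδ)

theorem span_eq [FiniteDimensional ℝ V] (he : IsOrthonormalFamily B δ e) (hδ : δ = 1 ∨ δ = -1)
    {W : Submodule ℝ V} (hW : Module.finrank ℝ W = Fintype.card ι) (heW : ∀ i, e i ∈ W) :
    Submodule.span ℝ (Set.range e) = W :=
  Submodule.eq_of_le_of_finrank_eq (Submodule.span_le.mpr (Set.range_subset_iff.mpr heW))
    (by rw [he.finrank_span hδ, hW])

end IsOrthonormalFamily

/-- The bilinear form `B` is symmetric and has a pseudo-orthonormal basis with `q` negative and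
`p` positive members. -/
def HasSignature (B : LinearMap.BilinForm ℝ V) (q p : ℕ) : Prop :=
  (∀ v w, B v w = B w v) ∧ ∃ b : Module.Basis (Fin q ⊕ Fin p) ℝ V,
    IsOrthonormalFamily B (-1) (fun i ↦ b (Sum.inl i)) ∧
    IsOrthonormalFamily B 1 (fun i ↦ b (Sum.inr i))

/-- A negative definite subspace of maximal dimension. -/
def IsMaximalNegative (B : LinearMap.BilinForm ℝ V) (q : ℕ) (W : Submodule ℝ V) : Prop :=
  Module.finrank ℝ W = q ∧ ∀ v ∈ W, v ≠ 0 → B v v < 0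

section Signature

variable {q p : ℕ} {W : Submodule ℝ V}

theorem HasSignature.finrank_eq (hB : HasSignature B q p) : Module.finrank ℝ V = q + p := by
  obtain ⟨b, -⟩ := hB.2
  rw [Module.finrank_eq_card_basis b]
  simp

theorem HasSignature.isRefl (hB : HasSignature B q p) : B.IsRefl :=
  fun v w h ↦ by rw [hB.1]; exact h

open Classical in
/-- The orthogonal projection onto a subspace that is complementary to its orthogonal complement
(and zero for other subspaces). -/
def orthProj (B : LinearMap.BilinForm ℝ V) (W : Submodule ℝ V) : V →ₗ[ℝ] V :=
  if h : IsCompl W (B.orthogonal W) then W.projection (B.orthogonal W) h else 0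

theorem orthProj_mem (h : IsCompl W (B.orthogonal W)) (v : V) : orthProj B W v ∈ W := by
  rw [orthProj, dif_pos h]
  exact Submodule.projection_apply_mem h v

theorem sub_orthProj_mem (h : IsCompl W (B.orthogonal W)) (v : V) :
    v - orthProj B W v ∈ B.orthogonal W := by
  rw [orthProj, dif_pos h]
  rw [← Submodule.projection_apply_eq_zero_iff h, map_sub,
    Submodule.projection_apply_of_mem_left h (Submodule.projection_apply_mem h v), sub_self]

theorem orthProj_eq (h : IsCompl W (B.orthogonal W)) {v w : V} (hw : w ∈ W)
    (hvw : v - w ∈ B.orthogonal W) : orthProj B W v = w := by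
  rw [← sub_eq_zero]
  refine (Submodule.disjoint_def.mp h.disjoint) _ (W.sub_mem (orthProj_mem h v) hw) ?_
  have := (B.orthogonal W).sub_mem hvw (sub_orthProj_mem h v)
  simpa using this

theorem orthProj_eq_sum (hB : ∀ v w, B v w = B w v) (h : IsCompl W (B.orthogonal W)) {δ : ℝ}
    (hδ : δ = 1 ∨ δ = -1)
    {ι : Type*} [Fintype ι] {e : ι → V} (he : IsOrthonormalFamily B δ e)
    (hspan : Submodule.span ℝ (Set.range e) = W) (v : V) :
    orthProj B W v = ∑ i, (δ * B v (e i)) • e i := by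
  refine orthProj_eq h (Submodule.sum_mem _ fun i _ ↦ Submodule.smul_mem _ _ ?_) ?_
  · rw [← hspan]
    exact Submodule.subset_span ⟨i, rfl⟩
  · rw [← hspan]
    intro u hu
    induction hu using Submodule.span_induction with
    | mem u hu =>
      obtain ⟨j, rfl⟩ := hu
      change B (e j) _ = 0
      rw [hB, map_sub, LinearMap.sub_apply, he.sum_apply]
      linear_combination (-(B v (e j))) * sign_mul_self hδ
    | zero => simp
    | add a b _ _ ha hb =>
      change B (a + b) _ = 0
      rw [map_add, LinearMap.add_apply, show B a _ = 0 from ha, show B b _ = 0 from hb, add_zero]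
    | smul t a _ ha =>
      change B (t • a) _ = 0
      rw [map_smul, LinearMap.smul_apply, show B a _ = 0 from ha, smul_zero]

/-- The operator that is the identity on `W` and multiplication by `t` on the orthogonal complement
of `W`. -/
def orthScaling (B : LinearMap.BilinForm ℝ V) (W : Submodule ℝ V) (t : ℝ) : V →ₗ[ℝ] V :=
  t • LinearMap.id + (1 - t) • orthProj B W

theorem orthScaling_apply (t : ℝ) (v : V) :
    orthScaling B W t v = t • v + (1 - t) • orthProj B W v := rfl

/-- Interpolation between two maximal negative subspaces: the second one is pushed towards the
first one by scaling its component orthogonal to the first one. -/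
def interpSubspace (B : LinearMap.BilinForm ℝ V) (W W' : Submodule ℝ V) (t : ℝ) :
    Submodule ℝ V :=
  W'.map (orthScaling B W t)

theorem interpSubspace_one (W W' : Submodule ℝ V) : interpSubspace B W W' 1 = W' := by
  have : orthScaling B W 1 = LinearMap.id := by
    ext v
    simp [orthScaling_apply]
  rw [interpSubspace, this, Submodule.map_id]

variable [FiniteDimensional ℝ V]

/-- The orthogonal complement of a maximal negative definite subspace is positive definite:
otherwise it would contain a vector enlarging the subspace to a negative semidefinite one, which
is too large to be disjoint from the positive part of a pseudo-orthonormal basis. -/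
theorem IsMaximalNegative.pos_of_mem_orthogonal (hW : IsMaximalNegative B q W)
    (hB : HasSignature B q p) {u : V} (hu : u ∈ B.orthogonal W) (hu0 : u ≠ 0) : 0 < B u u := by
  by_contra hle
  push Not at hle
  obtain ⟨b, -, hb⟩ := hB.2
  have huW : u ∉ W := fun h ↦ (hW.2 u h hu0).ne (hu u h)
  have hlt : W < W ⊔ Submodule.span ℝ {u} := by
    refine lt_of_le_of_ne le_sup_left fun h ↦ huW ?_
    rw [h]
    exact Submodule.mem_sup_right (Submodule.mem_span_singleton_self u)
  have hdisj : Disjoint (W ⊔ Submodule.span ℝ {u})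
      (Submodule.span ℝ (Set.range fun i ↦ b (Sum.inr i))) := by
    rw [Submodule.disjoint_def]
    intro z hz hzP
    by_contra hz0
    have h1 := hb.definite (Or.inl rfl) hzP hz0
    obtain ⟨w, hw, y, hy, rfl⟩ := Submodule.mem_sup.mp hz
    obtain ⟨c, rfl⟩ := Submodule.mem_span_singleton.mp hy
    have hwu : B w u = 0 := hu w hw
    have hww : B w w ≤ 0 := by
      by_cases hw0 : w = 0
      · simp [hw0]
      · exact (hW.2 w hw hw0).le
    simp only [map_add, LinearMap.add_apply, map_smul, LinearMap.smul_apply, smul_eq_mul,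
      hB.1 u w, hwu] at h1
    nlinarith [mul_self_nonneg c]
  have h1 := Submodule.finrank_lt_finrank_of_lt hlt
  have h2 := Submodule.finrank_add_finrank_le_of_disjoint hdisj
  rw [hb.finrank_span (Or.inl rfl), hB.finrank_eq, Fintype.card_fin] at h2
  rw [hW.1] at h1
  omega

theorem IsMaximalNegative.isCompl (hW : IsMaximalNegative B q W) (hB : HasSignature B q p) :
    IsCompl W (B.orthogonal W) := by
  rw [LinearMap.BilinForm.isCompl_orthogonal_iff_disjoint hB.isRefl, Submodule.disjoint_def]
  intro u hu hu'
  by_contra hu0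
  exact (hW.2 u hu hu0).ne (hu' u hu)

theorem IsMaximalNegative.finrank_orthogonal (hW : IsMaximalNegative B q W)
    (hB : HasSignature B q p) : Module.finrank ℝ (B.orthogonal W) = p := by
  have := Submodule.finrank_add_eq_of_isCompl (hW.isCompl hB)
  rw [hW.1, hB.finrank_eq] at this
  omega

/-- Shrinking the component of a vector orthogonal to a maximal negative subspace keeps the vector
negative. -/
theorem IsMaximalNegative.orthScaling_neg (hW : IsMaximalNegative B q W) (hB : HasSignature B q p)
    {t : ℝ} (ht0 : 0 ≤ t) (ht1 : t ≤ 1) {v : V} (hv : B v v < 0) :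
    B (orthScaling B W t v) (orthScaling B W t v) < 0 := by
  have hc := hW.isCompl hB
  set w := orthProj B W v with hw
  have hwW : w ∈ W := orthProj_mem hc v
  obtain ⟨u, hu⟩ : ∃ u, u = v - w := ⟨_, rfl⟩
  have huW : u ∈ B.orthogonal W := hu ▸ sub_orthProj_mem hc v
  have hwu : B w u = 0 := huW w hwW
  have hvu : v = w + u := by rw [hu]; abel
  have hA : orthScaling B W t v = w + t • u := by
    rw [orthScaling_apply, ← hw, hu, smul_sub, sub_smul, one_smul]
    abel
  have huu : 0 ≤ B u u := by
    by_cases hu0 : u = 0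
    · simp [hu0]
    · exact (hW.pos_of_mem_orthogonal hB huW hu0).le
  rw [hvu] at hv
  rw [hA]
  simp only [map_add, LinearMap.add_apply, map_smul, LinearMap.smul_apply, smul_eq_mul,
      hB.1 u w, hwu] at hv ⊢
  nlinarith [mul_nonneg (sub_nonneg.mpr (mul_le_one₀ ht1 ht0 ht1)) huu]

theorem IsMaximalNegative.orthScaling_ne_zero {W' : Submodule ℝ V} (hW : IsMaximalNegative B q W)
    (hW' : IsMaximalNegative B q W') (hB : HasSignature B q p) {t : ℝ} (ht0 : 0 ≤ t) (ht1 : t ≤ 1)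
    {v : V} (hv : v ∈ W') (h : orthScaling B W t v = 0) : v = 0 := by
  by_contra hv0
  have := hW.orthScaling_neg hB ht0 ht1 (hW'.2 v hv hv0)
  simp [h] at this

theorem IsMaximalNegative.interpSubspace {W' : Submodule ℝ V} (hW : IsMaximalNegative B q W)
    (hW' : IsMaximalNegative B q W') (hB : HasSignature B q p) {t : ℝ} (ht0 : 0 ≤ t) (ht1 : t ≤ 1) :
    IsMaximalNegative B q (interpSubspace B W W' t) := by
  constructor
  · have hinj : Function.Injective ((orthScaling B W t).domRestrict W') := by
      refine (injective_iff_map_eq_zero _).mpr fun v hv ↦ ?_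
      exact Subtype.ext (hW.orthScaling_ne_zero hW' hB ht0 ht1 v.2 hv)
    have := LinearMap.finrank_range_of_inj hinj
    rw [LinearMap.range_domRestrict, hW'.1] at this
    exact this
  · rintro _ ⟨v, hv, rfl⟩ hne
    exact hW.orthScaling_neg hB ht0 ht1 (hW'.2 v hv fun h0 ↦ hne (by rw [h0, map_zero]))

theorem interpSubspace_zero {W' : Submodule ℝ V} (hW : IsMaximalNegative B q W)
    (hW' : IsMaximalNegative B q W') (hB : HasSignature B q p) :
    interpSubspace B W W' 0 = W := by
  refine Submodule.eq_of_le_of_finrank_eq ?_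
    (by rw [(hW.interpSubspace hW' hB le_rfl zero_le_one).1, hW.1])
  rintro _ ⟨v, -, rfl⟩
  rw [orthScaling_apply, zero_smul, zero_add, sub_zero, one_smul]
  exact orthProj_mem (hW.isCompl hB) v

end Signature

end Bilinear

/-! ### Existence of splittings -/

section Splittings

open Topology

variable {q p : ℕ} {M : Type*} [TopologicalSpace M]
  [ChartedSpace (EuclideanSpace ℝ (Fin (q + p))) M] [IsManifold (𝓡 (q + p)) ∞ M]
  (g : SemiRiemannianMetric q p M)

instance finiteDimensional_tangentSpace (x : M) :
    FiniteDimensional ℝ (TangentSpace (𝓡 (q + p)) x) :=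
  inferInstanceAs (FiniteDimensional ℝ (EuclideanSpace ℝ (Fin (q + p))))

theorem SemiRiemannianMetric.bilin_apply (x : M) (v w : TangentSpace (𝓡 (q + p)) x) :
    g.bilin x v w = g.val x v w := rfl

theorem SemiRiemannianMetric.hasSignature (x : M) : HasSignature (g.bilin x) q p := by
  refine ⟨g.symm x, ?_⟩
  obtain ⟨b, h1, h2, h3⟩ := g.signature x
  exact ⟨b, ⟨h2, fun i j hij ↦ h1 _ _ fun h ↦ hij (Sum.inl_injective h)⟩,
    ⟨h3, fun i j hij ↦ h1 _ _ fun h ↦ hij (Sum.inr_injective h)⟩⟩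

/-- The family `W` has a smooth frame of `r` vector fields near `x₀`. -/
def HasSmoothFrameAt (r : ℕ) (W : ∀ x : M, Submodule ℝ (TangentSpace (𝓡 (q + p)) x)) (x₀ : M) :
    Prop :=
  ∃ U : Set M, IsOpen U ∧ x₀ ∈ U ∧ ∃ X : Fin r → ∀ x : M, TangentSpace (𝓡 (q + p)) x,
    (∀ i, SmoothVectorFieldOn U (X i)) ∧
    ∀ x ∈ U, LinearIndependent ℝ (fun i ↦ X i x) ∧
      Submodule.span ℝ (Set.range fun i ↦ X i x) = W x

/-- A `δ`-definite smooth subbundle has smooth orthonormal frames near every point. -/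
theorem HasSmoothFrameAt.exists_orthonormal_frame {δ : ℝ} (hδ : δ = 1 ∨ δ = -1) {r : ℕ}
    {W : ∀ x : M, Submodule ℝ (TangentSpace (𝓡 (q + p)) x)} {x₀ : M}
    (hW : HasSmoothFrameAt r W x₀)
    (hdef : ∀ v ∈ W x₀, v ≠ 0 → 0 < δ * g.val x₀ v v) :
    ∃ U : Set M, IsOpen U ∧ x₀ ∈ U ∧ ∃ e : Fin r → ∀ x : M, TangentSpace (𝓡 (q + p)) x,
      (∀ i, SmoothVectorFieldOn U (e i)) ∧ ∀ x ∈ U,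
        IsOrthonormalFamily (g.bilin x) δ (fun i ↦ e i x) ∧
        Submodule.span ℝ (Set.range fun i ↦ e i x) = W x := by
  obtain ⟨U, hU, hx₀, X, hX, hXW⟩ := hW
  obtain ⟨U', hU'U, hU', hx₀', e, he, heU⟩ := SpinGeometry.exists_orthonormal_frame g hδ hU hx₀ X hX
    (hXW x₀ hx₀).1 (by rwa [(hXW x₀ hx₀).2])
  refine ⟨U', hU', hx₀', e, he, fun x hx ↦ ?_⟩
  obtain ⟨h1, h2, h3⟩ := heU x hx
  have ho : IsOrthonormalFamily (g.bilin x) δ (fun i ↦ e i x) := ⟨h2, h3⟩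
  obtain ⟨h4, h5⟩ := hXW x (hU'U hx)
  refine ⟨ho, ho.span_eq hδ ?_ fun i ↦ h5 ▸ h1 i⟩
  rw [← h5, finrank_span_eq_card h4]

theorem HasSmoothFrameAt.congr {r : ℕ}
    {W W' : ∀ x : M, Submodule ℝ (TangentSpace (𝓡 (q + p)) x)} {x₀ : M}
    (h : ∀ᶠ x in 𝓝 x₀, W x = W' x) (hW : HasSmoothFrameAt r W x₀) : HasSmoothFrameAt r W' x₀ := by
  obtain ⟨U, hU, hx₀, X, hX, hXW⟩ := hW
  obtain ⟨V, hV, hVo, hxV⟩ := eventually_nhds_iff.mp h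
  exact ⟨U ∩ V, hU.inter hVo, ⟨hx₀, hxV⟩, X, fun i ↦ (hX i).mono Set.inter_subset_left,
    fun x hx ↦ ⟨(hXW x hx.1).1, (hXW x hx.1).2.trans (hV x hx.2)⟩⟩

theorem SmoothVectorFieldOn.orthProj {δ : ℝ} (hδ : δ = 1 ∨ δ = -1) {U : Set M} {r : ℕ}
    {W : ∀ x : M, Submodule ℝ (TangentSpace (𝓡 (q + p)) x)}
    (hW : ∀ x ∈ U, IsCompl (W x) ((g.bilin x).orthogonal (W x)))
    {e : Fin r → ∀ x : M, TangentSpace (𝓡 (q + p)) x} (he : ∀ i, SmoothVectorFieldOn U (e i))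
    (heW : ∀ x ∈ U, IsOrthonormalFamily (g.bilin x) δ (fun i ↦ e i x) ∧
        Submodule.span ℝ (Set.range fun i ↦ e i x) = W x)
    {X : ∀ x : M, TangentSpace (𝓡 (q + p)) x} (hX : SmoothVectorFieldOn U X) :
    SmoothVectorFieldOn U fun x ↦ SpinGeometry.orthProj (g.bilin x) (W x) (X x) := by
  refine SmoothVectorFieldOn.congr (X := fun x ↦ ∑ i, (δ * g.val x (X x) (e i x)) • e i x) ?_ ?_
  · exact SmoothVectorFieldOn.sum fun i _ ↦
      SmoothVectorFieldOn.smul (contMDiffOn_const.mul (g.contMDiffOn_val hX (he i))) (he i)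
  · intro x hx
    exact orthProj_eq_sum (g.symm x) (hW x hx) hδ (heW x hx).1 (heW x hx).2 (X x)

/-- Local solutions: extend a negative orthonormal system at `x₀` to smooth vector fields and
orthonormalize them. -/
theorem exists_maximalNegative_frame (x₀ : M) :
    ∃ W : ∀ x : M, Submodule ℝ (TangentSpace (𝓡 (q + p)) x),
      ∀ᶠ x in 𝓝 x₀, IsMaximalNegative (g.bilin x) q (W x) ∧ HasSmoothFrameAt q W x := by
  have hδ : (-1 : ℝ) = 1 ∨ (-1 : ℝ) = -1 := Or.inr rfl
  obtain ⟨-, b, hb, -⟩ := g.hasSignature x₀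
  obtain ⟨U, hU, hx₀, hext⟩ := exists_smoothVectorFieldOn_eq (n := q + p) x₀
  choose X hX hXx₀ using fun i : Fin q ↦ hext (b (Sum.inl i))
  have hXx : (fun i ↦ X i x₀) = fun i ↦ b (Sum.inl i) := funext hXx₀
  obtain ⟨U', -, hU', hx₀', e, he, heU⟩ := exists_orthonormal_frame g hδ hU hx₀ X hX
    (by rw [hXx]; exact hb.linearIndependent hδ)
    (by rw [hXx]; exact fun u hu hu0 ↦ hb.definite hδ hu hu0)
  refine ⟨fun x ↦ Submodule.span ℝ (Set.range fun i ↦ e i x), ?_⟩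
  filter_upwards [hU'.mem_nhds hx₀'] with x hx
  have ho : ∀ x ∈ U', IsOrthonormalFamily (g.bilin x) (-1) (fun i ↦ e i x) :=
    fun x hx ↦ (heU x hx).2
  refine ⟨⟨by rw [(ho x hx).finrank_span hδ, Fintype.card_fin], fun v hv hv0 ↦ ?_⟩,
    U', hU', hx, e, he, fun y hy ↦ ⟨(ho y hy).linearIndependent hδ, rfl⟩⟩
  have := (ho x hx).definite hδ hv hv0
  linarith

theorem hasSmoothFrameAt_interpSubspace {χ : M → ℝ} (hχ : ContMDiff (𝓡 (q + p)) 𝓘(ℝ, ℝ) ∞ χ)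
    (hχ01 : ∀ x, χ x ∈ Set.Icc (0 : ℝ) 1)
    {W W' : ∀ x : M, Submodule ℝ (TangentSpace (𝓡 (q + p)) x)}
    (hW : ∀ x, IsMaximalNegative (g.bilin x) q (W x))
    (hW' : ∀ x, IsMaximalNegative (g.bilin x) q (W' x)) {x₀ : M}
    (h : HasSmoothFrameAt q W x₀) (h' : HasSmoothFrameAt q W' x₀) :
    HasSmoothFrameAt q (fun x ↦ interpSubspace (g.bilin x) (W x) (W' x) (χ x)) x₀ := by
  obtain ⟨U, hU, hx₀, e, he, heU⟩ := h.exists_orthonormal_frame g (Or.inr rfl) fun v hv hv0 ↦ by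
      have := (hW x₀).2 v hv hv0
      rw [g.bilin_apply] at this
      linarith
  obtain ⟨U', hU', hx₀', X, hX, hXU'⟩ := h'
  refine ⟨U ∩ U', hU.inter hU', ⟨hx₀, hx₀'⟩,
    fun i x ↦ orthScaling (g.bilin x) (W x) (χ x) (X i x), fun i ↦ ?_, ?_⟩
  · have hXi : SmoothVectorFieldOn (U ∩ U') (X i) := (hX i).mono Set.inter_subset_right
    refine (SmoothVectorFieldOn.smul hχ.contMDiffOn hXi).add (SmoothVectorFieldOn.smul
      (contMDiffOn_const.sub hχ.contMDiffOn) (SmoothVectorFieldOn.orthProj g (Or.inr rfl)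
        (fun x _ ↦ (hW x).isCompl (g.hasSignature x))
        (fun i ↦ (he i).mono Set.inter_subset_left) (fun x hx ↦ heU x hx.1) hXi))
  · rintro x ⟨-, hx⟩
    obtain ⟨h1, h2⟩ := hXU' x hx
    constructor
    · refine h1.map_injOn (orthScaling (g.bilin x) (W x) (χ x)) ?_
      rw [h2]
      intro v hv w hw hvw
      rw [← sub_eq_zero]
      refine (hW x).orthScaling_ne_zero (hW' x) (g.hasSignature x) (hχ01 x).1 (hχ01 x).2
        (Submodule.sub_mem _ hv hw) ?_
      rw [map_sub, hvw, sub_self]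
    · change _ = (W' x).map _
      rw [← h2, Submodule.map_span, ← Set.range_comp]
      rfl

theorem exists_linearIndependent_mem {V : Type*} [AddCommGroup V] [Module ℝ V]
    [FiniteDimensional ℝ V] {N : Submodule ℝ V} {k : ℕ} (hN : Module.finrank ℝ N = k) :
    ∃ b : Fin k → V, LinearIndependent ℝ b ∧ ∀ i, b i ∈ N := by
  let b := Module.finBasisOfFinrankEq ℝ N hN
  exact ⟨fun i ↦ b i, b.linearIndependent.map' N.subtype (Submodule.ker_subtype N),
    fun i ↦ (b i).2⟩

/-- The orthogonal complement of a smooth maximal negative subbundle is a smooth subbundle. -/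
theorem hasSmoothFrameAt_orthogonal {W : ∀ x : M, Submodule ℝ (TangentSpace (𝓡 (q + p)) x)}
    (hW : ∀ x, IsMaximalNegative (g.bilin x) q (W x)) {x₀ : M} (h : HasSmoothFrameAt q W x₀) :
    HasSmoothFrameAt p (fun x ↦ (g.bilin x).orthogonal (W x)) x₀ := by
  have hδ : (1 : ℝ) = 1 ∨ (1 : ℝ) = -1 := Or.inl rfl
  have hcompl := fun x ↦ (hW x).isCompl (g.hasSignature x)
  obtain ⟨U, hU, hx₀, e, he, heU⟩ := h.exists_orthonormal_frame g (Or.inr rfl) fun v hv hv0 ↦ by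
      have := (hW x₀).2 v hv hv0
      rw [g.bilin_apply] at this
      linarith
  obtain ⟨U₀, hU₀, hx₀₀, hext⟩ := exists_smoothVectorFieldOn_eq (n := q + p) x₀
  obtain ⟨b, hb, hbW⟩ := exists_linearIndependent_mem
    ((hW x₀).finrank_orthogonal (g.hasSignature x₀))
  choose X hX hXx₀ using fun i : Fin p ↦ hext (b i)
  set Y : Fin p → ∀ x : M, TangentSpace (𝓡 (q + p)) x :=
    fun i x ↦ X i x - orthProj (g.bilin x) (W x) (X i x) with hY
  have hYU : ∀ i, SmoothVectorFieldOn (U ∩ U₀) (Y i) := fun i ↦ by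
    have hXi : SmoothVectorFieldOn (U ∩ U₀) (X i) := (hX i).mono Set.inter_subset_right
    exact hXi.sub (SmoothVectorFieldOn.orthProj g (Or.inr rfl) (fun x _ ↦ hcompl x)
        (fun i ↦ (he i).mono Set.inter_subset_left) (fun x hx ↦ heU x hx.1) hXi)
  have hYW : ∀ i x, Y i x ∈ (g.bilin x).orthogonal (W x) := fun i x ↦
    sub_orthProj_mem (hcompl x) _
  have hYx₀ : (fun i ↦ Y i x₀) = b := by
    funext i
    change X i x₀ - orthProj _ _ (X i x₀) = _
    rw [orthProj_eq (hcompl x₀) (Submodule.zero_mem _), hXx₀, sub_zero]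
    rw [hXx₀, sub_zero]
    exact hbW i
  obtain ⟨U', hU'U, hU', hx₀', f, hf, hfU⟩ := exists_orthonormal_frame g hδ (hU.inter hU₀)
    ⟨hx₀, hx₀₀⟩ Y hYU
    (by rw [hYx₀]; exact hb)
    (by
      intro u hu hu0
      have hu' : u ∈ (g.bilin x₀).orthogonal (W x₀) :=
        Submodule.span_le.mpr (Set.range_subset_iff.mpr fun i ↦ hYW i x₀) hu
      rw [one_mul]
      exact (hW x₀).pos_of_mem_orthogonal (g.hasSignature x₀) hu' hu0)
  refine ⟨U', hU', hx₀', f, hf, fun x hx ↦ ?_⟩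
  obtain ⟨h1, h2⟩ := hfU x hx
  have ho : IsOrthonormalFamily (g.bilin x) 1 (fun i ↦ f i x) := h2
  refine ⟨ho.linearIndependent hδ, ho.span_eq hδ ?_ fun i ↦ ?_⟩
  · rw [(hW x).finrank_orthogonal (g.hasSignature x), Fintype.card_fin]
  · exact Submodule.span_le.mpr (Set.range_subset_iff.mpr fun i ↦ hYW i x) (h1 i)

/-- Every semi-Riemannian manifold has a splitting: maximal negative subspaces can be interpolated,
which allows local negative subbundles to be glued. -/
theorem exists_isSplitting [T2Space M] [SigmaCompactSpace M] :
    ∃ Eneg Epos, IsSplitting g Eneg Epos := by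
  obtain ⟨W, hW, hWs⟩ := exists_good_section (n := q + p) (M := M)
    (X := fun x ↦ Submodule ℝ (TangentSpace (𝓡 (q + p)) x))
    (fun x W ↦ IsMaximalNegative (g.bilin x) q W)
    (fun x W W' t ↦ interpSubspace (g.bilin x) W W' t)
    (fun W x ↦ HasSmoothFrameAt q W x)
    (fun x W W' h h' ↦ interpSubspace_zero h h' (g.hasSignature x))
    (fun x W W' _ _ ↦ interpSubspace_one W W')
    (fun x W W' t h h' ht0 ht1 ↦ h.interpSubspace h' (g.hasSignature x) ht0 ht1)
    (fun W W' x h hW ↦ hW.congr h)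
    (fun χ W W' x hχ h01 hW hW' h h' ↦ hasSmoothFrameAt_interpSubspace g hχ h01 hW hW' h h')
    (exists_maximalNegative_frame g)
  refine ⟨W, fun x ↦ (g.bilin x).orthogonal (W x), ⟨hWs, fun x ↦
    hasSmoothFrameAt_orthogonal g hW (hWs x), fun x ↦ (hW x).isCompl (g.hasSignature x),
    fun x v hv w hw ↦ hw v hv, fun x ↦ (hW x).2, fun x v hv hv0 ↦
    (hW x).pos_of_mem_orthogonal (g.hasSignature x) hv hv0⟩⟩

end Splittings

/-! ### Adapted frames of a splitting -/

section DefiniteSplittings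

variable {q p : ℕ} {M : Type*} [TopologicalSpace M]
  [ChartedSpace (EuclideanSpace ℝ (Fin (q + p))) M] [IsManifold (𝓡 (q + p)) ∞ M]
  {g : SemiRiemannianMetric q p M}

/-- An orthogonal splitting of the tangent bundle into a `δ`-definite subbundle `W` of rank `r`
and a `-δ`-definite subbundle `W'` of rank `r'`.  Taking `δ = -1` or `δ = 1` treats the two
members of a splitting on an equal footing. -/
structure IsDefiniteSplitting (g : SemiRiemannianMetric q p M) (δ : ℝ) (r r' : ℕ)
    (W W' : ∀ x : M, Submodule ℝ (TangentSpace (𝓡 (q + p)) x)) : Prop where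
  smooth : IsSmoothSubbundle r W
  smooth' : IsSmoothSubbundle r' W'
  isCompl : ∀ x, IsCompl (W x) (W' x)
  orthogonal : ∀ x, ∀ v ∈ W x, ∀ w ∈ W' x, g.val x v w = 0
  definite : ∀ x, ∀ v ∈ W x, v ≠ 0 → 0 < δ * g.val x v v
  definite' : ∀ x, ∀ v ∈ W' x, v ≠ 0 → 0 < -δ * g.val x v v

variable {W W' : ∀ x : M, Submodule ℝ (TangentSpace (𝓡 (q + p)) x)}

theorem IsSplitting.isDefiniteSplitting_neg (h : IsSplitting g W W') :
    IsDefiniteSplitting g (-1) q p W W' where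
  smooth := h.neg_smooth
  smooth' := h.pos_smooth
  isCompl := h.isCompl
  orthogonal := h.orthogonal
  definite x v hv hv0 := by linarith [h.neg_def x v hv hv0]
  definite' x v hv hv0 := by linarith [h.pos_def x v hv hv0]

theorem IsDefiniteSplitting.swap {δ : ℝ} {r r' : ℕ} (h : IsDefiniteSplitting g δ r r' W W') :
    IsDefiniteSplitting g (-δ) r' r W' W where
  smooth := h.smooth'
  smooth' := h.smooth
  isCompl x := (h.isCompl x).symm
  orthogonal x v hv w hw := by rw [g.symm]; exact h.orthogonal x w hw v hv
  definite := h.definite'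
  definite' x v hv hv0 := by rw [neg_neg]; exact h.definite x v hv hv0

theorem IsSplitting.isDefiniteSplitting_pos (h : IsSplitting g W W') :
    IsDefiniteSplitting g 1 p q W' W := by
  simpa using h.isDefiniteSplitting_neg.swap

/-- A smooth orthonormal frame on `U` of the family of subspaces `W`. -/
structure IsOrthonormalFrameOn (g : SemiRiemannianMetric q p M) (δ : ℝ) {r : ℕ} (U : Set M)
    (W : ∀ x : M, Submodule ℝ (TangentSpace (𝓡 (q + p)) x)) (e : Fin r → ∀ x, W x) : Prop where
  smooth : ∀ i, SmoothVectorFieldOn U fun x ↦ (e i x : TangentSpace (𝓡 (q + p)) x)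
  orthonormal : ∀ x ∈ U, IsOrthonormalFamily (g.bilin x) δ
    fun i ↦ (e i x : TangentSpace (𝓡 (q + p)) x)
  span : ∀ x ∈ U, Submodule.span ℝ
    (Set.range fun i ↦ (e i x : TangentSpace (𝓡 (q + p)) x)) = W x

theorem IsOrthonormalFrameOn.mono {δ : ℝ} {r : ℕ} {U V : Set M} {e : Fin r → ∀ x, W x}
    (he : IsOrthonormalFrameOn g δ U W e) (h : V ⊆ U) : IsOrthonormalFrameOn g δ V W e :=
  ⟨fun i ↦ (he.smooth i).mono h, fun x hx ↦ he.orthonormal x (h hx), fun x hx ↦ he.span x (h hx)⟩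

theorem exists_isOrthonormalFrameOn {δ : ℝ} (hδ : δ = 1 ∨ δ = -1) {r : ℕ}
    (hW : IsSmoothSubbundle r W) (hdef : ∀ x, ∀ v ∈ W x, v ≠ 0 → 0 < δ * g.val x v v) (x₀ : M) :
    ∃ U : Set M, IsOpen U ∧ x₀ ∈ U ∧ ∃ e : Fin r → ∀ x, W x, IsOrthonormalFrameOn g δ U W e := by
  classical
  obtain ⟨U, hU, hx₀, e, he, heU⟩ :=
    HasSmoothFrameAt.exists_orthonormal_frame g hδ (hW x₀) (hdef x₀)
  have hmem : ∀ x ∈ U, ∀ i, e i x ∈ W x := fun x hx i ↦ by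
    rw [← (heU x hx).2]
    exact Submodule.subset_span ⟨i, rfl⟩
  have heq : ∀ x ∈ U, ∀ i, (((if h : x ∈ U then ⟨e i x, hmem x h i⟩ else 0 : W x)) :
      TangentSpace (𝓡 (q + p)) x) = e i x := fun x hx i ↦ by rw [dif_pos hx]
  refine ⟨U, hU, hx₀, fun i x ↦ if h : x ∈ U then ⟨e i x, hmem x h i⟩ else 0,
    fun i ↦ (he i).congr fun x hx ↦ heq x hx i, fun x hx ↦ ?_, fun x hx ↦ ?_⟩
  · simp only [heq x hx]
    exact (heU x hx).1
  · simp only [heq x hx]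
    exact (heU x hx).2

theorem SemiRiemannianMetric.polar_quad (x : M) (v w : TangentSpace (𝓡 (q + p)) x) :
    QuadraticMap.polar (g.quad x) v w = 2 * g.val x v w := by
  rw [SemiRiemannianMetric.quad, LinearMap.BilinMap.polar_toQuadraticMap, g.bilin_apply,
    g.bilin_apply, g.symm x w v, two_mul]

theorem IsDefiniteSplitting.exists_adaptedFrame {δ : ℝ} (hδ : δ = 1 ∨ δ = -1) {r r' : ℕ}
    (h : IsDefiniteSplitting g δ r r' W W') (x₀ : M) :
    ∃ U : Set M, IsOpen U ∧ x₀ ∈ U ∧ ∃ (e : Fin r → ∀ x, W x) (f : Fin r' → ∀ x, W' x),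
      IsOrthonormalFrameOn g δ U W e ∧ IsOrthonormalFrameOn g (-δ) U W' f ∧
      ∀ x ∈ U, IsAdaptedFrame (g.quad x) δ (fun i ↦ (e i x : TangentSpace (𝓡 (q + p)) x))
        (fun i ↦ (f i x : TangentSpace (𝓡 (q + p)) x)) := by
  have hδ' : -δ = 1 ∨ -δ = -1 := by rcases hδ with rfl | rfl <;> simp
  obtain ⟨U, hU, hx, e, he⟩ := exists_isOrthonormalFrameOn hδ h.smooth h.definite x₀
  obtain ⟨U', hU', hx', f, hf⟩ := exists_isOrthonormalFrameOn hδ' h.smooth' h.definite' x₀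
  refine ⟨U ∩ U', hU.inter hU', ⟨hx, hx'⟩, e, f, he.mono Set.inter_subset_left,
    hf.mono Set.inter_subset_right, fun x hx ↦ ⟨fun i j hij ↦ ?_, fun i j hij ↦ ?_,
    fun i j ↦ ?_, (he.orthonormal x hx.1).1, (hf.orthonormal x hx.2).1, ?_⟩⟩
  · rw [g.polar_quad, ← g.bilin_apply, (he.orthonormal x hx.1).2 i j hij, mul_zero]
  · rw [g.polar_quad, ← g.bilin_apply, (hf.orthonormal x hx.2).2 i j hij, mul_zero]
  · rw [g.polar_quad, h.orthogonal x _ (e i x).2 _ (f j x).2, mul_zero]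
  · rw [Submodule.span_union, he.span x hx.1, hf.span x hx.2, (h.isCompl x).sup_eq_top]

end DefiniteSplittings

/-! ### Orientability of definite subbundles -/

section AlternatingMaps

variable {E : Type*} [AddCommGroup E] [Module ℝ E]

/-- Forms of top degree are proportional. -/
theorem AlternatingMap.eq_smul_of_basis {ι : Type*} [Fintype ι] [DecidableEq ι]
    (b : Module.Basis ι ℝ E) (f h : E [⋀^ι]→ₗ[ℝ] ℝ) (hf : f b ≠ 0) : h = (h b / f b) • f := by
  rw [h.eq_smul_basis_det b, f.eq_smul_basis_det b, smul_smul]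
  congr 1
  simp only [AlternatingMap.smul_apply, Module.Basis.det_self, smul_eq_mul, mul_one]
  field_simp

/-- An alternating map in `ι ⊕ ι'` variables with the variables in `ι` fixed. -/
def fixLeft {ι ι' : Type*} (α : E [⋀^(ι ⊕ ι')]→ₗ[ℝ] ℝ) (v : ι → E) : E [⋀^ι']→ₗ[ℝ] ℝ :=
  { α.toMultilinearMap.currySum v with
    map_eq_zero_of_eq' := fun w i j hw hij ↦
      α.map_eq_zero_of_eq (Sum.elim v w) (i := Sum.inr i) (j := Sum.inr j) (by simpa using hw)
        (by simpa using hij) }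

end AlternatingMaps

section Orientability

open Topology

variable {q p : ℕ} {M : Type*} [TopologicalSpace M]
  [ChartedSpace (EuclideanSpace ℝ (Fin (q + p))) M] [IsManifold (𝓡 (q + p)) ∞ M]
  {g : SemiRiemannianMetric q p M} {r : ℕ}
  {W : ∀ x : M, Submodule ℝ (TangentSpace (𝓡 (q + p)) x)}

/-- The field `τ` of forms of top degree on the subspaces `W x` is smooth near `x₀`: it is smooth on
smooth sections over all small open sets near `x₀`. -/
def IsSmoothFormAt (τ : ∀ x : M, (W x) [⋀^Fin r]→ₗ[ℝ] ℝ) (x₀ : M) : Prop :=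
  ∃ U : Set M, IsOpen U ∧ x₀ ∈ U ∧ ∀ V ⊆ U, IsOpen V → ∀ X : Fin r → ∀ x : M, W x,
    (∀ i, SmoothVectorFieldOn V (fun x ↦ (X i x : TangentSpace (𝓡 (q + p)) x))) →
    ContMDiffOn (𝓡 (q + p)) 𝓘(ℝ, ℝ) ∞ (fun x ↦ τ x (fun i ↦ X i x)) V

/-- The members of an orthonormal frame as a basis of the subspace. -/
def IsOrthonormalFrameOn.basis {δ : ℝ} {U : Set M} {e : Fin r → ∀ x, W x}
    (he : IsOrthonormalFrameOn g δ U W e) (hδ : δ = 1 ∨ δ = -1) {x : M} (hx : x ∈ U) :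
    Module.Basis (Fin r) ℝ (W x) :=
  Module.Basis.mk (v := fun i ↦ e i x)
    (LinearIndependent.of_comp (W x).subtype ((he.orthonormal x hx).linearIndependent hδ))
    (by
      rintro ⟨v, hv⟩ -
      have h : v ∈ (Submodule.span ℝ (Set.range fun i ↦ e i x)).map (W x).subtype := by
        rw [Submodule.map_span, ← Set.range_comp]
        change v ∈ Submodule.span ℝ (Set.range fun i ↦ (e i x : TangentSpace (𝓡 (q + p)) x))
        rwa [he.span x hx]
      obtain ⟨y, hy, rfl⟩ := h
      exact hy)

theorem IsOrthonormalFrameOn.coe_basis {δ : ℝ} {U : Set M} {e : Fin r → ∀ x, W x}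
    (he : IsOrthonormalFrameOn g δ U W e) (hδ : δ = 1 ∨ δ = -1) {x : M} (hx : x ∈ U) :
    ⇑(he.basis hδ hx) = fun i ↦ e i x :=
  Module.Basis.coe_mk _ _

theorem IsOrthonormalFrameOn.basis_repr {δ : ℝ} {U : Set M} {e : Fin r → ∀ x, W x}
    (he : IsOrthonormalFrameOn g δ U W e) (hδ : δ = 1 ∨ δ = -1) {x : M} (hx : x ∈ U) (v : W x)
    (i : Fin r) : (he.basis hδ hx).repr v i = δ * g.val x v (e i x) := by
  have h1 : v = ∑ i, (δ * g.val x v (e i x)) • (he.basis hδ hx) i := by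
    apply Subtype.ext
    rw [he.coe_basis hδ hx]
    have := (he.orthonormal x hx).eq_sum_of_mem_span hδ (u := v) (by rw [he.span x hx]; exact v.2)
    simpa [g.bilin_apply] using this
  conv_lhs => rw [h1]
  rw [Module.Basis.repr_sum_self]

/-- A field of forms of top degree is smooth if it is smooth on one orthonormal frame. -/
theorem IsOrthonormalFrameOn.isSmoothFormAt {δ : ℝ} {U : Set M} {e : Fin r → ∀ x, W x}
    (he : IsOrthonormalFrameOn g δ U W e) (hδ : δ = 1 ∨ δ = -1) (hU : IsOpen U)
    {τ : ∀ x : M, (W x) [⋀^Fin r]→ₗ[ℝ] ℝ}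
    (hτ : ContMDiffOn (𝓡 (q + p)) 𝓘(ℝ, ℝ) ∞ (fun x ↦ τ x fun i ↦ e i x) U) {x₀ : M}
    (hx₀ : x₀ ∈ U) : IsSmoothFormAt τ x₀ := by
  refine ⟨U, hU, hx₀, fun V hV _ X hX ↦ ?_⟩
  have hdet : ContMDiffOn (𝓡 (q + p)) 𝓘(ℝ, ℝ) ∞
      (fun x ↦ (Matrix.of fun i j ↦ δ * g.val x (X j x) (e i x)).det) V := by
    simp only [Matrix.det_apply']
    refine contMDiffOn_finsetSum fun s _ ↦
      contMDiffOn_const.mul (contMDiffOn_finsetProd fun i _ ↦ ?_)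
    exact contMDiffOn_const.mul (g.contMDiffOn_val (hX _) ((he.smooth _).mono hV))
  refine (hdet.mul (hτ.mono hV)).congr fun x hx ↦ ?_
  have h1 := DFunLike.congr_fun ((τ x).eq_smul_basis_det (he.basis hδ (hV hx))) fun i ↦ X i x
  rw [AlternatingMap.smul_apply, Module.Basis.det_apply, smul_eq_mul, mul_comm,
    he.coe_basis hδ (hV hx)] at h1
  have h2 : (he.basis hδ (hV hx)).toMatrix (fun i ↦ X i x) =
      Matrix.of fun i j ↦ δ * g.val x (X j x) (e i x) := by
    ext i j
    rw [Module.Basis.toMatrix_apply, he.basis_repr]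
    rfl
  rw [h2] at h1
  exact h1

/-- A ray of forms of top degree in each fibre, with smooth local representatives, yields an
orientation. -/
theorem isOrientableSubbundle_of_rays [T2Space M] [SigmaCompactSpace M]
    (hW : IsSmoothSubbundle r W) (R : ∀ x, Set ((W x) [⋀^Fin r]→ₗ[ℝ] ℝ))
    (hne : ∀ x, ∀ a ∈ R x, a ≠ 0) (hpos : ∀ x, ∀ a ∈ R x, ∀ b ∈ R x, ∃ k : ℝ, 0 < k ∧ b = k • a)
    (hloc : ∀ x₀, ∃ τ : ∀ x, (W x) [⋀^Fin r]→ₗ[ℝ] ℝ,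
      ∀ᶠ x in 𝓝 x₀, τ x ∈ R x ∧ IsSmoothFormAt τ x) :
    IsOrientableSubbundle r W := by
  obtain ⟨τ, hτ, hτs⟩ := exists_good_section (n := q + p) (M := M)
    (X := fun x ↦ (W x) [⋀^Fin r]→ₗ[ℝ] ℝ)
    (fun x a ↦ ∀ b ∈ R x, ∃ k : ℝ, 0 < k ∧ a = k • b)
    (fun x a b t ↦ (1 - t) • a + t • b) (fun τ x ↦ IsSmoothFormAt τ x)
    (fun x a b _ _ ↦ by simp) (fun x a b _ _ ↦ by simp)
    (fun x a b t ha hb ht0 ht1 c hc ↦ by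
      obtain ⟨k, hk, rfl⟩ := ha c hc
      obtain ⟨l, hl, rfl⟩ := hb c hc
      refine ⟨(1 - t) * k + t * l, ?_, by rw [add_smul, mul_smul, mul_smul]⟩
      rcases ht0.eq_or_lt with rfl | ht
      · simpa using hk
      · exact add_pos_of_nonneg_of_pos (mul_nonneg (by linarith) hk.le) (mul_pos ht hl))
    (fun τ τ' x h hτ ↦ by
      obtain ⟨U, hU, hx, hUτ⟩ := hτ
      obtain ⟨V, hV, hVo, hxV⟩ := eventually_nhds_iff.mp h
      refine ⟨U ∩ V, hU.inter hVo, ⟨hx, hxV⟩, fun V' hV' hV'o X hX ↦ ?_⟩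
      exact (hUτ V' (hV'.trans Set.inter_subset_left) hV'o X hX).congr fun y hy ↦ by
        rw [hV y (hV' hy).2])
    (fun χ τ τ' x hχ _ _ _ h h' ↦ by
      obtain ⟨U, hU, hx, hUτ⟩ := h
      obtain ⟨U', hU', hx', hUτ'⟩ := h'
      refine ⟨U ∩ U', hU.inter hU', ⟨hx, hx'⟩, fun V hV hVo X hX ↦ ?_⟩
      exact ((contMDiffOn_const.sub hχ.contMDiffOn).mul
        (hUτ V (hV.trans Set.inter_subset_left) hVo X hX)).add
        (hχ.contMDiffOn.mul (hUτ' V (hV.trans Set.inter_subset_right) hVo X hX)))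
    (fun x₀ ↦ by
      obtain ⟨τ, hτ⟩ := hloc x₀
      refine ⟨τ, ?_⟩
      filter_upwards [hτ] with x hx
      exact ⟨fun b hb ↦ hpos x b hb _ hx.1, hx.2⟩)
  refine ⟨hW, τ, fun x ↦ ?_, fun U hU X hX x hx ↦ ?_⟩
  · obtain ⟨σ, hσ⟩ := hloc x
    obtain ⟨k, hk, hk'⟩ := hτ x _ hσ.self_of_nhds.1
    rw [hk']
    exact smul_ne_zero hk.ne' (hne x _ hσ.self_of_nhds.1)
  · obtain ⟨V, hV, hxV, hVτ⟩ := hτs x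
    have := hVτ (V ∩ U) Set.inter_subset_left (hV.inter hU) X
      fun i ↦ (hX i).mono Set.inter_subset_right
    exact ((this x ⟨hxV, hx⟩).contMDiffAt ((hV.inter hU).mem_nhds ⟨hxV, hx⟩)).contMDiffWithinAt

end Orientability

/-! ### Orientation of the complement of a definite subbundle -/

section ComplementOrientation

open Topology

variable {q p : ℕ} {M : Type*} [TopologicalSpace M]
  [ChartedSpace (EuclideanSpace ℝ (Fin (q + p))) M] [IsManifold (𝓡 (q + p)) ∞ M]
  {g : SemiRiemannianMetric q p M} {W W' : ∀ x : M, Submodule ℝ (TangentSpace (𝓡 (q + p)) x)}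

theorem AlternatingMap.exists_basis_of_ne_zero {E : Type*} [AddCommGroup E] [Module ℝ E] {r : ℕ}
    [FiniteDimensional ℝ E] (hE : Module.finrank ℝ E = r) (τ : E [⋀^Fin r]→ₗ[ℝ] ℝ) (e : Fin r → E)
    (he : τ e ≠ 0) : ∃ b : Module.Basis (Fin r) ℝ E, ⇑b = e := by
  have hli : LinearIndependent ℝ e := by
    by_contra h
    exact he (τ.map_linearDependent e h)
  have hcard : Fintype.card (Fin r) = Module.finrank ℝ E := by rw [hE, Fintype.card_fin]
  by_cases hr : r = 0
  · subst hr
    have : Subsingleton E := Module.finrank_zero_iff.mp hE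
    exact ⟨Module.Basis.empty E, Subsingleton.elim _ _⟩
  · have : Nonempty (Fin r) := ⟨⟨0, Nat.pos_of_ne_zero hr⟩⟩
    exact ⟨basisOfLinearIndependentOfCardEqFinrank hli hcard,
      coe_basisOfLinearIndependentOfCardEqFinrank hli hcard⟩

/-- On an orientable manifold, the orthogonal complement of an orientable definite subbundle is
orientable: contract a volume form of the manifold with a frame `e` of the subbundle and multiply
by the value of the orientation form on `e`.  A change of `e` multiplies the result by the square
of a determinant. -/
theorem IsDefiniteSplitting.isOrientableSubbundle_compl [T2Space M] [SigmaCompactSpace M] {δ : ℝ}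
    (hδ : δ = 1 ∨ δ = -1) {r r' : ℕ} (h : IsDefiniteSplitting g δ r r' W W')
    (s : Fin r ⊕ Fin r' ≃ Fin (q + p)) (hM : IsOrientableManifold (q + p) M)
    (hW : IsOrientableSubbundle r W) : IsOrientableSubbundle r' W' := by
  have hδ' : -δ = 1 ∨ -δ = -1 := by rcases hδ with rfl | rfl <;> simp
  obtain ⟨-, ν, hν0, hνs⟩ := hM
  obtain ⟨-, τ, hτ0, hτs⟩ := hW
  -- the volume form of the manifold, with its slots divided between the two subbundles
  let α : ∀ x, TangentSpace (𝓡 (q + p)) x [⋀^(Fin r ⊕ Fin r')]→ₗ[ℝ] ℝ := fun x ↦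
    ((ν x).compLinearMap (Submodule.topEquiv (R := ℝ)
      (M := TangentSpace (𝓡 (q + p)) x)).symm.toLinearMap).domDomCongr s.symm
  have hα0 : ∀ x, α x ≠ 0 := fun x h0 ↦ hν0 x (by
    ext v
    have := DFunLike.congr_fun h0 fun i ↦ (v (s i) : TangentSpace (𝓡 (q + p)) x)
    have hv : (fun i ↦ (Submodule.topEquiv (R := ℝ)).symm (v i : TangentSpace (𝓡 (q + p)) x)) = v :=
      funext fun i ↦ Subtype.ext rfl
    simpa [α, hv] using this)
  let A : ∀ x, (Fin r → W x) → (W' x) [⋀^Fin r']→ₗ[ℝ] ℝ := fun x e ↦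
    (fixLeft (α x) fun i ↦ (e i : TangentSpace (𝓡 (q + p)) x)).compLinearMap (W' x).subtype
  have hA : ∀ x e w, A x e w = α x (Sum.elim (fun i ↦ e i) fun i ↦ w i) := fun _ _ _ ↦ rfl
  have hbasis : ∀ x, ∀ e : Fin r → W x, τ x e ≠ 0 → ∃ b : Module.Basis (Fin r) ℝ (W x), ⇑b = e := by
    intro x e he
    obtain ⟨U, _, hx, e₀, f₀, he₀, -⟩ := h.exists_adaptedFrame hδ x
    refine AlternatingMap.exists_basis_of_ne_zero ?_ (τ x) e he
    rw [Module.finrank_eq_card_basis (he₀.basis hδ hx), Fintype.card_fin]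
  -- in its first `r` slots the volume form is a top degree form on `W`, hence proportional to `τ`
  have hratio : ∀ x, ∀ e e' : Fin r → W x, τ x e ≠ 0 → A x e' = (τ x e' / τ x e) • A x e := by
    intro x e e' he
    obtain ⟨b, rfl⟩ := hbasis x e he
    ext w
    let B : (W x) [⋀^Fin r]→ₗ[ℝ] ℝ := (fixLeft ((α x).domDomCongr (Equiv.sumComm _ _))
      fun i ↦ (w i : TangentSpace (𝓡 (q + p)) x)).compLinearMap (W x).subtype
    have hB : ∀ e, B e = A x e w := fun e ↦ by
      rw [hA]
      change α x (fun i ↦ Sum.elim _ _ (Sum.swap i)) = _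
      congr 1
      funext i
      rcases i with i | i <;> rfl
    have := DFunLike.congr_fun (AlternatingMap.eq_smul_of_basis b (τ x) B he) e'
    rw [AlternatingMap.smul_apply, hB, hB] at this
    rw [this, AlternatingMap.smul_apply, smul_eq_mul, smul_eq_mul]
    ring
  refine isOrientableSubbundle_of_rays h.smooth'
    (fun x ↦ {a | ∃ e : Fin r → W x, τ x e ≠ 0 ∧ a = τ x e • A x e}) ?_ ?_ ?_
  · rintro x _ ⟨e, he, rfl⟩
    refine smul_ne_zero he fun h0 ↦ hα0 x ?_
    obtain ⟨b, rfl⟩ := hbasis x e he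
    obtain ⟨U, _, hx, e₀, f₀, -, hf₀, -⟩ := h.exists_adaptedFrame hδ x
    let b' := hf₀.basis hδ' hx
    let bb : Module.Basis (Fin r ⊕ Fin r') ℝ (TangentSpace (𝓡 (q + p)) x) :=
      (b.prod b').map (Submodule.prodEquivOfIsCompl (W x) (W' x) (h.isCompl x))
    rw [← AlternatingMap.map_basis_eq_zero_iff bb]
    have h1 := DFunLike.congr_fun h0 fun i ↦ b' i
    rw [hA] at h1
    have h2 : ⇑bb = Sum.elim (fun i ↦ (b i : TangentSpace (𝓡 (q + p)) x))
        fun i ↦ (b' i : TangentSpace (𝓡 (q + p)) x) := by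
      funext i
      rcases i with i | i <;> simp [bb]
    rw [h2]
    exact h1
  · rintro x _ ⟨e, he, rfl⟩ _ ⟨e', he', rfl⟩
    refine ⟨(τ x e' / τ x e) ^ 2, by positivity, ?_⟩
    rw [hratio x e e' he, smul_smul, smul_smul]
    congr 1
    field_simp
  · intro x₀
    obtain ⟨U, hU, hx₀, e, f, he, hf, -⟩ := h.exists_adaptedFrame hδ x₀
    refine ⟨fun x ↦ τ x (fun i ↦ e i x) • A x fun i ↦ e i x, ?_⟩
    filter_upwards [hU.mem_nhds hx₀] with x hx
    refine ⟨⟨fun i ↦ e i x, ?_, rfl⟩, hf.isSmoothFormAt hδ' hU ?_ hx⟩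
    · rw [← he.coe_basis hδ hx]
      exact (AlternatingMap.map_basis_ne_zero_iff _ _).mpr (hτ0 x)
    · refine (hτs U hU e he.smooth).mul ?_
      refine hνs U hU (fun k x ↦ ⟨Sum.elim (fun i ↦ (e i x : TangentSpace (𝓡 (q + p)) x))
        (fun j ↦ (f j x : TangentSpace (𝓡 (q + p)) x)) (s.symm k), trivial⟩) fun k ↦ ?_
      rcases hk : s.symm k with i | j
      · simpa [hk] using he.smooth i
      · simpa [hk] using hf.smooth j

end ComplementOrientation

/-! ### The orientation form of a product on spinors -/

section SignForm

variable {V : Type*} [AddCommGroup V] [Module ℝ V] {Q : QuadraticForm ℝ V}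
  {S : Type*} [AddCommGroup S] [Module ℂ S]

/-- The alternating form `(v₁, …, v_r) ↦ Re H(ψ, c v₁ ∧ ⋯ ∧ v_r ψ)` defined by a sesquilinear form
`H` and a spinor `ψ`; here `c` is the factor `volRoot δ r`. -/
def signForm (ρ : ComplexClifford Q ≃ₐ[ℂ] Module.End ℂ S) (δ : ℝ) (r : ℕ)
    (H : S →ₗ⋆[ℂ] S →ₗ[ℂ] ℂ) (ψ : S) : V [⋀^Fin r]→ₗ[ℝ] ℝ :=
  LinearMap.compAlternatingMap
    { toFun := fun a ↦ (volRoot δ r * H ψ (realAction ρ a ψ)).re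
      map_add' := fun a b ↦ by simp only [realAction_add, LinearMap.add_apply, map_add, mul_add,
        Complex.add_re]
      map_smul' := fun t a ↦ by
        rw [realAction_smul, LinearMap.smul_apply, map_smul, smul_eq_mul, mul_left_comm,
          Complex.re_ofReal_mul]
        rfl }
    (cliffordAlt Q r)

variable {ρ : ComplexClifford Q ≃ₐ[ℂ] Module.End ℂ S} {δ σ : ℝ} {r r' : ℕ} {e : Fin r → V}
  {f : Fin r' → V} {H h : S →ₗ⋆[ℂ] S →ₗ[ℂ] ℂ}

theorem IsAdaptedFrame.signForm_eq (he : IsAdaptedFrame Q δ e f) (H : S →ₗ⋆[ℂ] S →ₗ[ℂ] ℂ) (ψ : S) :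
    signForm ρ δ r H ψ e = (volumeForm ρ δ e H 1 ψ ψ).re := by
  change (volRoot δ r * H ψ (realAction ρ (cliffordAlt Q r e) ψ)).re = _
  rw [cliffordAlt_of_orthogonal Q e he.orth_e, volumeForm_apply, Complex.ofReal_one, one_mul]
  rfl

theorem IsAdaptedFrame.signForm_volumeForm (he : IsAdaptedFrame Q δ e f) (hδ : δ = 1 ∨ δ = -1)
    (t : ℝ) (ψ : S) : signForm ρ δ r (volumeForm ρ δ e h t) ψ e = t * (h ψ ψ).re := by
  rw [he.signForm_eq, volumeForm_apply, Complex.ofReal_one, one_mul, ← smul_eq_mul, ← map_smul,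
    volumeForm_involution he hδ, Complex.re_ofReal_mul]

/-- The `signForm` of a non-degenerate vector-adjoint form is definite in `ψ`. -/
theorem IsVectorAdjoint.exists_signForm_eq [FiniteDimensional ℂ S] [Nontrivial S]
    (hH : IsVectorAdjoint σ ρ H) (hn : H.Nondegenerate) (hh : IsCompatibleForm ρ e f h)
    (he : IsAdaptedFrame Q δ e f) (hδ : δ = 1 ∨ δ = -1) (hσ2 : σ = 1 ∨ σ = -1)
    (hσ : σ * δ = -(-1) ^ r) :
    ∃ t : ℝ, t ≠ 0 ∧ ∀ ψ, signForm ρ δ r H ψ e = t * (h ψ ψ).re := by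
  obtain ⟨t, ht, h1⟩ := hH.exists_volumeForm_eq hn hh he hδ hσ2 hσ
  exact ⟨t, ht, fun ψ ↦ by rw [he.signForm_eq, h1, Complex.re_ofReal_mul]⟩

/-- The standard hermitian form in the coordinates of a basis. -/
def stdForm {ι : Type*} [Fintype ι] (b : Module.Basis ι ℂ S) : S →ₗ⋆[ℂ] S →ₗ[ℂ] ℂ :=
  LinearMap.mk₂'ₛₗ (starRingEnd ℂ) (RingHom.id ℂ) (fun ψ φ ↦ ∑ i, conj (b.repr ψ i) * b.repr φ i)
    (fun ψ ψ' φ ↦ by simp [add_mul, Finset.sum_add_distrib])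
    (fun z ψ φ ↦ by simp [mul_assoc, Finset.mul_sum])
    (fun ψ φ φ' ↦ by simp [mul_add, Finset.sum_add_distrib])
    (fun z ψ φ ↦ by simp [mul_left_comm, Finset.mul_sum])

theorem stdForm_apply {ι : Type*} [Fintype ι] (b : Module.Basis ι ℂ S) (ψ φ : S) :
    stdForm b ψ φ = ∑ i, conj (b.repr ψ i) * b.repr φ i := rfl

theorem isPosDefForm_stdForm {ι : Type*} [Fintype ι] (b : Module.Basis ι ℂ S) :
    IsPosDefForm (stdForm b) := by
  refine ⟨fun ψ φ ↦ ?_, fun ψ hψ ↦ ?_⟩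
  · rw [stdForm_apply, stdForm_apply, map_sum]
    refine Finset.sum_congr rfl fun i _ ↦ ?_
    rw [map_mul, Complex.conj_conj, mul_comm]
  · have h1 : (stdForm b ψ ψ).re = ∑ i, Complex.normSq (b.repr ψ i) := by
      rw [stdForm_apply, Complex.re_sum]
      refine Finset.sum_congr rfl fun i _ ↦ ?_
      rw [← Complex.normSq_eq_conj_mul_self, Complex.ofReal_re]
    rw [h1]
    refine (Finset.sum_nonneg fun i _ ↦ Complex.normSq_nonneg _).lt_of_ne' fun h0 ↦ hψ ?_
    rw [Finset.sum_eq_zero_iff_of_nonneg fun i _ ↦ Complex.normSq_nonneg _] at h0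
    refine b.repr.map_eq_zero_iff.mp (Finsupp.ext fun i ↦ ?_)
    exact Complex.normSq_eq_zero.mp (h0 i (Finset.mem_univ i))

theorem IsAdaptedFrame.isCompatibleForm_averageForm (he : IsAdaptedFrame Q δ e f)
    (hδ : δ = 1 ∨ δ = -1) (hh : IsPosDefForm h) :
    IsCompatibleForm ρ e f (averageForm h (frameOperators ρ e f)) :=
  ⟨isPosDefForm_averageForm hh _, he.averageForm_invariant ρ hδ h⟩

theorem nontrivial_of_algEquiv (ρ : ComplexClifford Q ≃ₐ[ℂ] Module.End ℂ S) : Nontrivial S := by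
  have : Invertible (2 : ℝ) := invertibleOfNonzero two_ne_zero
  have : Nontrivial (ComplexClifford Q) := inferInstance
  by_contra hS
  rw [not_nontrivial_iff_subsingleton] at hS
  have : Subsingleton (Module.End ℂ S) := inferInstance
  have : Nontrivial (Module.End ℂ S) := ρ.symm.toEquiv.nontrivial
  exact false_of_nontrivial_of_subsingleton (Module.End ℂ S)

end SignForm

/-! ### Smooth fields of forms on a spinor bundle -/

section SpinorFields

open Topology

variable {q p : ℕ} {M : Type*} [TopologicalSpace M]
  [ChartedSpace (EuclideanSpace ℝ (Fin (q + p))) M] [IsManifold (𝓡 (q + p)) ∞ M]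
  {g : SemiRiemannianMetric q p M}
  {F : Type*} [NormedAddCommGroup F] [NormedSpace ℂ F]
  {S : M → Type*} [TopologicalSpace (TotalSpace F S)] [∀ x, TopologicalSpace (S x)]
  [∀ x, AddCommGroup (S x)] [∀ x, Module ℂ (S x)]
  [FiberBundle F S]

variable (F) in
/-- The field of forms `H` is smooth on all smooth sections of `S` over open subsets of `U`. -/
def IsSmoothFieldOn (n : ℕ) {M : Type*} [TopologicalSpace M]
    [ChartedSpace (EuclideanSpace ℝ (Fin n)) M] {S : M → Type*} [TopologicalSpace (TotalSpace F S)]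
    [∀ x, TopologicalSpace (S x)] [∀ x, AddCommGroup (S x)] [∀ x, Module ℂ (S x)] [FiberBundle F S]
    (U : Set M) (H : ∀ x : M, S x →ₗ⋆[ℂ] S x →ₗ[ℂ] ℂ) : Prop :=
  ∀ V ⊆ U, IsOpen V → ∀ ψ φ : ∀ x, S x, SmoothSectionOn n F V ψ → SmoothSectionOn n F V φ →
    ContMDiffOn (𝓡 n) 𝓘(ℝ, ℂ) ∞ (fun x ↦ H x (ψ x) (φ x)) V

theorem SpinorBundleStructure.smooth_cliffordProd (c : SpinorBundleStructure F S g) {U : Set M}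
    (hU : IsOpen U) {k : ℕ} (e : Fin k → ∀ x : M, TangentSpace (𝓡 (q + p)) x)
    (he : ∀ i, SmoothVectorFieldOn U (e i)) {φ : ∀ x, S x} (hφ : SmoothSectionOn (q + p) F U φ) :
    SmoothSectionOn (q + p) F U
      fun x ↦ realAction (c.rep x) (cliffordProd (g.quad x) fun i ↦ e i x) (φ x) := by
  induction k with
  | zero => simpa [cliffordProd, realAction_one] using hφ
  | succ k ih =>
    have h1 := c.smooth U hU (e 0) _ (he 0) (ih (fun i ↦ e i.succ) fun i ↦ he _)
    simp only [cliffordProd, List.ofFn_succ, List.prod_cons, realAction_mul, Module.End.mul_apply]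
    exact h1

theorem IsSmoothFieldOn.averageForm (c : SpinorBundleStructure F S g) {U : Set M}
    {m : ∀ x : M, S x →ₗ⋆[ℂ] S x →ₗ[ℂ] ℂ} (hm : IsSmoothFieldOn F (q + p) U m)
    (L : List (∀ x : M, TangentSpace (𝓡 (q + p)) x)) (hL : ∀ X ∈ L, SmoothVectorFieldOn U X) :
    IsSmoothFieldOn F (q + p) U fun x ↦ SpinGeometry.averageForm (m x)
      (L.map fun X ↦ realAction (c.rep x) (CliffordAlgebra.ι (g.quad x) (X x))) := by
  induction L with
  | nil => exact hm
  | cons X L ih =>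
    have ih' := ih fun Y hY ↦ hL Y (List.mem_cons_of_mem _ hY)
    intro V hV hVo ψ φ hψ hφ
    have hX := (hL X List.mem_cons_self).mono hV
    exact (ih' V hV hVo ψ φ hψ hφ).add (ih' V hV hVo _ _ (c.smooth V hVo X ψ hX hψ)
      (c.smooth V hVo X φ hX hφ))

theorem contMDiffOn_ofReal {n : ℕ} {M : Type*} [TopologicalSpace M]
    [ChartedSpace (EuclideanSpace ℝ (Fin n)) M] {U : Set M} {f : M → ℝ}
    (hf : ContMDiffOn (𝓡 n) 𝓘(ℝ, ℝ) ∞ f U) :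
    ContMDiffOn (𝓡 n) 𝓘(ℝ, ℂ) ∞ (fun x ↦ (f x : ℂ)) U :=
  (Complex.ofRealCLM.contDiff.contMDiff).comp_contMDiffOn hf

theorem contMDiffOn_re {n : ℕ} {M : Type*} [TopologicalSpace M]
    [ChartedSpace (EuclideanSpace ℝ (Fin n)) M] {U : Set M} {f : M → ℂ}
    (hf : ContMDiffOn (𝓡 n) 𝓘(ℝ, ℂ) ∞ f U) :
    ContMDiffOn (𝓡 n) 𝓘(ℝ, ℝ) ∞ (fun x ↦ (f x).re) U :=
  (Complex.reCLM.contDiff.contMDiff).comp_contMDiffOn hf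

theorem contMDiffOn_complex_mul {n : ℕ} {M : Type*} [TopologicalSpace M]
    [ChartedSpace (EuclideanSpace ℝ (Fin n)) M] {U : Set M} {f f' : M → ℂ}
    (hf : ContMDiffOn (𝓡 n) 𝓘(ℝ, ℂ) ∞ f U) (hf' : ContMDiffOn (𝓡 n) 𝓘(ℝ, ℂ) ∞ f' U) :
    ContMDiffOn (𝓡 n) 𝓘(ℝ, ℂ) ∞ (fun x ↦ f x * f' x) U :=
  (contDiff_mul (𝕜 := ℝ) (𝔸 := ℂ)).contMDiff.comp_contMDiffOn (hf.prodMk_space hf')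

theorem IsSmoothFieldOn.volumeForm (c : SpinorBundleStructure F S g) {U : Set M}
    {h : ∀ x : M, S x →ₗ⋆[ℂ] S x →ₗ[ℂ] ℂ} (hh : IsSmoothFieldOn F (q + p) U h) (δ : ℝ) {k : ℕ}
    (e : Fin k → ∀ x : M, TangentSpace (𝓡 (q + p)) x) (he : ∀ i, SmoothVectorFieldOn U (e i))
    {t : M → ℝ} (ht : ContMDiffOn (𝓡 (q + p)) 𝓘(ℝ, ℝ) ∞ t U) :
    IsSmoothFieldOn F (q + p) U fun x ↦
      SpinGeometry.volumeForm (c.rep x) δ (fun i ↦ e i x) (h x) (t x) := by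
  intro V hV hVo ψ φ hψ hφ
  simp only [volumeForm_apply]
  exact contMDiffOn_complex_mul
    (contMDiffOn_complex_mul (contMDiffOn_ofReal (ht.mono hV)) contMDiffOn_const)
    (hh V hV hVo ψ _ hψ (c.smooth_cliffordProd hVo e (fun i ↦ (he i).mono hV) hφ))

theorem contMDiffOn_repr {n : ℕ} {M : Type*} [TopologicalSpace M]
    [ChartedSpace (EuclideanSpace ℝ (Fin n)) M] {S : M → Type*} [TopologicalSpace (TotalSpace F S)]
    [∀ x, TopologicalSpace (S x)] [∀ x, AddCommGroup (S x)] [∀ x, Module ℂ (S x)] [FiberBundle F S]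
    [VectorBundle ℝ F S] [ContMDiffVectorBundle ∞ F S (𝓡 n)] [FiniteDimensional ℂ F] {ι : Type*}
    (b : Module.Basis ι ℂ F) (x₀ : M) {V : Set M} (hV : V ⊆ (trivializationAt F S x₀).baseSet)
    (hVo : IsOpen V) {ψ : ∀ x, S x} (hψ : SmoothSectionOn n F V ψ) (i : ι) :
    ContMDiffOn (𝓡 n) 𝓘(ℝ, ℂ) ∞
      (fun x ↦ b.repr (trivializationAt F S x₀ ⟨x, ψ x⟩).2 i) V := by
  have h1 := ((trivializationAt F S x₀).contMDiffOn_section_iff hVo hV).mp hψ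
  have h2 : ContDiff ℝ ∞ (fun v : F ↦ b.repr v i) :=
    ((LinearMap.toContinuousLinearMap (b.coord i)).restrictScalars ℝ).contDiff
  exact h2.contMDiff.comp_contMDiffOn h1

variable [VectorBundle ℂ F S]

/-- The basis of the fibre over `x` defined by a basis of the typical fibre and a
trivialization. -/
def fibreBasis {ι : Type*} (b : Module.Basis ι ℂ F) (x₀ : M) {x : M}
    (hx : x ∈ (trivializationAt F S x₀).baseSet) : Module.Basis ι ℂ (S x) :=
  b.map ((trivializationAt F S x₀).linearEquivAt ℂ x hx).symm

theorem fibreBasis_repr {ι : Type*} (b : Module.Basis ι ℂ F) (x₀ : M) {x : M}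
    (hx : x ∈ (trivializationAt F S x₀).baseSet) (ψ : S x) (i : ι) :
    (fibreBasis b x₀ hx).repr ψ i = b.repr (trivializationAt F S x₀ ⟨x, ψ⟩).2 i := by
  simp [fibreBasis]

theorem finiteDimensional_fibre [FiniteDimensional ℂ F] (x : M) : FiniteDimensional ℂ (S x) :=
  Module.Basis.finiteDimensional_of_finite (fibreBasis (Module.finBasis ℂ F) x
    (FiberBundle.mem_baseSet_trivializationAt' x))

variable [VectorBundle ℝ F S] [ContMDiffVectorBundle ∞ F S (𝓡 (q + p))]

/-- Near every point there is a smooth field of positive definite hermitian forms on the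
fibres. -/
theorem exists_posDef_field {n : ℕ} {M : Type*} [TopologicalSpace M]
    [ChartedSpace (EuclideanSpace ℝ (Fin n)) M] {S : M → Type*} [TopologicalSpace (TotalSpace F S)]
    [∀ x, TopologicalSpace (S x)] [∀ x, AddCommGroup (S x)] [∀ x, Module ℂ (S x)] [FiberBundle F S]
    [VectorBundle ℂ F S] [VectorBundle ℝ F S] [ContMDiffVectorBundle ∞ F S (𝓡 n)]
    [FiniteDimensional ℂ F] (x₀ : M) :
    ∃ U : Set M, IsOpen U ∧ x₀ ∈ U ∧ ∃ m : ∀ x : M, S x →ₗ⋆[ℂ] S x →ₗ[ℂ] ℂ,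
      IsSmoothFieldOn F n U m ∧ ∀ x ∈ U, IsPosDefForm (m x) := by
  classical
  let b := Module.finBasis ℂ F
  set t := trivializationAt F S x₀ with ht
  refine ⟨t.baseSet, t.open_baseSet, FiberBundle.mem_baseSet_trivializationAt' x₀,
    fun x ↦ if hx : x ∈ t.baseSet then stdForm (fibreBasis b x₀ hx) else 0, ?_, ?_⟩
  · intro V hV hVo ψ φ hψ hφ
    have h1 : ContMDiffOn (𝓡 n) 𝓘(ℝ, ℂ) ∞
        (fun x ↦ ∑ i, conj (b.repr (t ⟨x, ψ x⟩).2 i) * b.repr (t ⟨x, φ x⟩).2 i) V := by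
      refine contMDiffOn_finsetSum fun i _ ↦
        contMDiffOn_complex_mul ?_ (contMDiffOn_repr b x₀ hV hVo hφ i)
      exact (Complex.conjCLE.contDiff.contMDiff).comp_contMDiffOn
        (contMDiffOn_repr b x₀ hV hVo hψ i)
    refine h1.congr fun x hx ↦ ?_
    dsimp only
    rw [dif_pos (hV hx), stdForm_apply]
    simp only [fibreBasis_repr]
    rfl
  · intro x hx
    dsimp only
    rw [dif_pos hx]
    exact isPosDefForm_stdForm _

theorem exists_ne_zero_section {n : ℕ} {M : Type*} [TopologicalSpace M]
    [ChartedSpace (EuclideanSpace ℝ (Fin n)) M] {S : M → Type*} [TopologicalSpace (TotalSpace F S)]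
    [∀ x, TopologicalSpace (S x)] [∀ x, AddCommGroup (S x)] [∀ x, Module ℂ (S x)] [FiberBundle F S]
    [VectorBundle ℂ F S] [VectorBundle ℝ F S] [ContMDiffVectorBundle ∞ F S (𝓡 n)]
    [Nontrivial F] (x₀ : M) :
    ∃ U : Set M, IsOpen U ∧ x₀ ∈ U ∧ ∃ ψ : ∀ x, S x, SmoothSectionOn n F U ψ ∧
      ∀ x ∈ U, ψ x ≠ 0 := by
  obtain ⟨v, hv⟩ := exists_ne (0 : F)
  set t := trivializationAt F S x₀
  have h1 : ∀ x ∈ t.baseSet, (t ⟨x, t.symm x v⟩).2 = v := fun x hx ↦ by rw [t.apply_mk_symm hx]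
  refine ⟨t.baseSet, t.open_baseSet, FiberBundle.mem_baseSet_trivializationAt' x₀,
    fun x ↦ t.symm x v, ?_, fun x hx h0 ↦ hv ?_⟩
  · exact (t.contMDiffOn_section_baseSet_iff).mpr ((contMDiffOn_const (c := v)).congr h1)
  · have h2 := h1 x hx
    rw [show t.symm x v = 0 from h0] at h2
    rw [← h2]
    exact (t.linear ℂ hx).map_zero

variable {W W' : ∀ x : M, Submodule ℝ (TangentSpace (𝓡 (q + p)) x)}

/-- A smooth non-degenerate vector-adjoint field `H` orients the definite subbundle whose volume
element turns `H` into a definite form: the orientation forms `signForm` of `H` for the various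
non-zero spinors at a point make up a ray. -/
theorem IsDefiniteSplitting.isOrientableSubbundle_of_field [T2Space M] [SigmaCompactSpace M]
    [FiniteDimensional ℂ F] (c : SpinorBundleStructure F S g) {δ σ : ℝ} (hδ : δ = 1 ∨ δ = -1)
    (hσ2 : σ = 1 ∨ σ = -1) {r r' : ℕ} (hσ : σ * δ = -(-1) ^ r)
    (hW : IsDefiniteSplitting g δ r r' W W') {H : ∀ x : M, S x →ₗ⋆[ℂ] S x →ₗ[ℂ] ℂ}
    (hHs : IsSmoothSesquilinearField (q := q) (p := p) F H)
    (hH : ∀ x, IsVectorAdjoint σ (c.rep x) (H x) ∧ (H x).Nondegenerate) :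
    IsOrientableSubbundle r W := by
  have hkey : ∀ x, ∃ b : Module.Basis (Fin r) ℝ (W x), ∃ t : ℝ, t ≠ 0 ∧
      ∃ h : S x →ₗ⋆[ℂ] S x →ₗ[ℂ] ℂ, IsPosDefForm h ∧ ∀ ψ, signForm (c.rep x) δ r (H x) ψ
        (fun i ↦ (b i : TangentSpace (𝓡 (q + p)) x)) = t * (h ψ ψ).re := by
    intro x
    have := finiteDimensional_fibre (F := F) (S := S) x
    have := nontrivial_of_algEquiv (c.rep x)
    obtain ⟨U, -, hx, e, f, he, -, hef⟩ := hW.exists_adaptedFrame hδ x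
    have hm := isPosDefForm_stdForm (Module.finBasis ℂ (S x))
    have hc := (hef x hx).isCompatibleForm_averageForm (ρ := c.rep x) hδ hm
    obtain ⟨t, ht, h1⟩ := (hH x).1.exists_signForm_eq (hH x).2 hc (hef x hx) hδ hσ2 hσ
    refine ⟨he.basis hδ hx, t, ht, _, hc.toIsPosDefForm, fun ψ ↦ ?_⟩
    rw [he.coe_basis hδ hx]
    exact h1 ψ
  refine isOrientableSubbundle_of_rays hW.smooth
    (fun x ↦ {a | ∃ ψ : S x, ψ ≠ 0 ∧
      a = (signForm (c.rep x) δ r (H x) ψ).compLinearMap (W x).subtype}) ?_ ?_ ?_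
  · rintro x _ ⟨ψ, hψ, rfl⟩ h0
    obtain ⟨b, t, ht, h, hh, h1⟩ := hkey x
    have h2 := DFunLike.congr_fun h0 fun i ↦ b i
    refine mul_ne_zero ht (hh.pos ψ hψ).ne' ((h1 ψ).symm.trans h2)
  · rintro x _ ⟨ψ, hψ, rfl⟩ _ ⟨φ, hφ, rfl⟩
    obtain ⟨b, t, ht, h, hh, h1⟩ := hkey x
    have hval : ∀ ψ, (signForm (c.rep x) δ r (H x) ψ).compLinearMap (W x).subtype b =
        t * (h ψ ψ).re := h1
    refine ⟨_, ?_, AlternatingMap.eq_smul_of_basis b _ _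
      (by rw [hval]; exact mul_ne_zero ht (hh.pos ψ hψ).ne')⟩
    rw [hval, hval, mul_div_mul_left _ _ ht]
    exact div_pos (hh.pos φ hφ) (hh.pos ψ hψ)
  · intro x₀
    have hF : Nontrivial F := by
      have := nontrivial_of_algEquiv (c.rep x₀)
      exact ((trivializationAt F S x₀).linearEquivAt ℂ x₀
        (FiberBundle.mem_baseSet_trivializationAt' x₀)).symm.toEquiv.nontrivial
    obtain ⟨U, hU, hx₀, e, f, he, -, hef⟩ := hW.exists_adaptedFrame hδ x₀
    obtain ⟨U', hU', hx₀', ψ, hψ, hψ0⟩ := exists_ne_zero_section (n := q + p) (F := F) (S := S) x₀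
    refine ⟨fun x ↦ (signForm (c.rep x) δ r (H x) (ψ x)).compLinearMap (W x).subtype, ?_⟩
    filter_upwards [(hU.inter hU').mem_nhds ⟨hx₀, hx₀'⟩] with x hx
    refine ⟨⟨ψ x, hψ0 x hx.2, rfl⟩, (he.mono Set.inter_subset_left).isSmoothFormAt hδ
      (hU.inter hU') ?_ hx⟩
    have hψ' : SmoothSectionOn (q + p) F (U ∩ U') ψ := ContMDiffOn.mono hψ Set.inter_subset_right
    have hH' : IsSmoothFieldOn F (q + p) (U ∩ U') H :=
      fun V _ hVo ψ φ hψ hφ ↦ hHs V hVo ψ φ hψ hφ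
    have h1 := contMDiffOn_re (hH'.volumeForm c δ
      (fun i x ↦ (e i x : TangentSpace (𝓡 (q + p)) x))
      (fun i ↦ (he.smooth i).mono Set.inter_subset_left) (t := fun _ ↦ 1) contMDiffOn_const _
      subset_rfl (hU.inter hU') ψ ψ hψ' hψ')
    refine h1.congr fun y hy ↦ ?_
    exact (hef y hy.1).signForm_eq (H y) (ψ y)

end SpinorFields

/-! ### Products from orientations -/

section ProductOfOrientation

open Topology

section Fibre

variable {V : Type*} [AddCommGroup V] [Module ℝ V] {Q : QuadraticForm ℝ V}
  {S : Type*} [AddCommGroup S] [Module ℂ S] {ρ : ComplexClifford Q ≃ₐ[ℂ] Module.End ℂ S}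
  {δ σ : ℝ} {r : ℕ}

theorem signForm_apply (H : S →ₗ⋆[ℂ] S →ₗ[ℂ] ℂ) (ψ : S) (v : Fin r → V) :
    signForm ρ δ r H ψ v = (volRoot δ r * H ψ (realAction ρ (cliffordAlt Q r v) ψ)).re := rfl

theorem signForm_add_smul (a b : ℝ) (H H' : S →ₗ⋆[ℂ] S →ₗ[ℂ] ℂ) (ψ : S) (v : Fin r → V) :
    signForm ρ δ r ((a : ℂ) • H + (b : ℂ) • H') ψ v =
      a * signForm ρ δ r H ψ v + b * signForm ρ δ r H' ψ v := by
  simp only [signForm_apply, LinearMap.add_apply, LinearMap.smul_apply, smul_eq_mul, mul_add,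
    mul_left_comm _ (a : ℂ), mul_left_comm _ (b : ℂ), Complex.add_re, Complex.re_ofReal_mul]

theorem IsVectorAdjoint.add_smul {H H' : S →ₗ⋆[ℂ] S →ₗ[ℂ] ℂ} (hH : IsVectorAdjoint σ ρ H)
    (hH' : IsVectorAdjoint σ ρ H') (a b : ℝ) :
    IsVectorAdjoint σ ρ ((a : ℂ) • H + (b : ℂ) • H') := by
  refine ⟨fun ψ φ ↦ ?_, fun u ψ φ ↦ ?_⟩
  · simp only [LinearMap.add_apply, LinearMap.smul_apply, smul_eq_mul, map_add, map_mul,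
      Complex.conj_ofReal, hH.hermitian, hH'.hermitian]
  · simp only [LinearMap.add_apply, LinearMap.smul_apply, smul_eq_mul, hH.adjoint, hH'.adjoint]
    ring

/-- The form `H` is positive with respect to the orientation form `τ` of the subspace `W`: its
orientation form `signForm` lies, for every non-zero spinor, on the ray of `τ`. -/
def IsOrientedForm (ρ : ComplexClifford Q ≃ₐ[ℂ] Module.End ℂ S) (δ : ℝ) {W : Submodule ℝ V}
    (τ : W [⋀^Fin r]→ₗ[ℝ] ℝ) (H : S →ₗ⋆[ℂ] S →ₗ[ℂ] ℂ) : Prop :=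
  ∀ v : Fin r → W, τ v ≠ 0 → ∀ ψ : S, ψ ≠ 0 → 0 < τ v * signForm ρ δ r H ψ fun i ↦ (v i : V)

variable {W : Submodule ℝ V} {τ : W [⋀^Fin r]→ₗ[ℝ] ℝ} {H H' : S →ₗ⋆[ℂ] S →ₗ[ℂ] ℂ}

theorem IsOrientedForm.interp (hH : IsOrientedForm ρ δ τ H) (hH' : IsOrientedForm ρ δ τ H')
    {t : ℝ} (ht0 : 0 ≤ t) (ht1 : t ≤ 1) :
    IsOrientedForm ρ δ τ (((1 - t : ℝ) : ℂ) • H + (t : ℂ) • H') := by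
  intro v hv ψ hψ
  rw [signForm_add_smul, mul_add, mul_left_comm, mul_left_comm _ t]
  have h1 := hH v hv ψ hψ
  have h2 := hH' v hv ψ hψ
  rcases ht0.eq_or_lt with rfl | ht
  · simpa using h1
  · exact add_pos_of_nonneg_of_pos (mul_nonneg (by linarith) h1.le) (mul_pos ht h2)

/-- A vector-adjoint form that is positive for some orientation is non-degenerate, as
`H(ψ, Λψ) ≠ 0` for a suitable element `Λ` of the Clifford algebra. -/
theorem IsOrientedForm.nondegenerate (hH : IsOrientedForm ρ δ τ H) (hA : IsVectorAdjoint σ ρ H)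
    (hτ : τ ≠ 0) : H.Nondegenerate := by
  obtain ⟨v, hv⟩ : ∃ v, τ v ≠ 0 := by
    by_contra! h0
    exact hτ (AlternatingMap.ext h0)
  have hsep : ∀ ψ, (∀ φ, H ψ φ = 0) → ψ = 0 := fun ψ h0 ↦ by
    by_contra hψ
    have := hH v hv ψ hψ
    rw [signForm_apply, h0] at this
    simp at this
  exact ⟨hsep, fun ψ h0 ↦ hsep ψ fun φ ↦ by rw [← hA.hermitian, h0, map_zero]⟩

/-- The local solution: the factor `τ b` makes the twisted form independent of the orientation of
the frame `b`. -/
theorem IsAdaptedFrame.isOrientedForm_volumeForm {r' : ℕ} {b : Module.Basis (Fin r) ℝ W}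
    {f : Fin r' → V} {h : S →ₗ⋆[ℂ] S →ₗ[ℂ] ℂ}
    (he : IsAdaptedFrame Q δ (fun i ↦ (b i : V)) f) (hδ : δ = 1 ∨ δ = -1) (hh : IsPosDefForm h)
    (hτ : τ ≠ 0) :
    IsOrientedForm ρ δ τ (volumeForm ρ δ (fun i ↦ (b i : V)) h (τ b)) := by
  have hb : τ b ≠ 0 := (AlternatingMap.map_basis_ne_zero_iff _ _).mpr hτ
  intro v hv ψ hψ
  have h1 := DFunLike.congr_fun (AlternatingMap.eq_smul_of_basis b τ
    ((signForm ρ δ r (volumeForm ρ δ (fun i ↦ (b i : V)) h (τ b)) ψ).compLinearMap W.subtype) hb) v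
  have h2 : (signForm ρ δ r (volumeForm ρ δ (fun i ↦ (b i : V)) h (τ b)) ψ).compLinearMap
      W.subtype b = τ b * (h ψ ψ).re := he.signForm_volumeForm hδ _ ψ
  rw [h2, mul_div_cancel_left₀ _ hb] at h1
  have h3 : signForm ρ δ r (volumeForm ρ δ (fun i ↦ (b i : V)) h (τ b)) ψ (fun i ↦ (v i : V)) =
      (h ψ ψ).re * τ v := h1
  rw [h3, mul_left_comm]
  exact mul_pos (hh.pos ψ hψ) (mul_self_pos.mpr hv)

end Fibre

variable {q p : ℕ} {M : Type*} [TopologicalSpace M]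
  [ChartedSpace (EuclideanSpace ℝ (Fin (q + p))) M] [IsManifold (𝓡 (q + p)) ∞ M]
  {g : SemiRiemannianMetric q p M}
  {F : Type*} [NormedAddCommGroup F] [NormedSpace ℂ F]
  {S : M → Type*} [TopologicalSpace (TotalSpace F S)] [∀ x, TopologicalSpace (S x)]
  [∀ x, AddCommGroup (S x)] [∀ x, Module ℂ (S x)]
  [FiberBundle F S] [VectorBundle ℂ F S] [VectorBundle ℝ F S]
  [ContMDiffVectorBundle ∞ F S (𝓡 (q + p))]
  {W W' : ∀ x : M, Submodule ℝ (TangentSpace (𝓡 (q + p)) x)}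

/-- An orientation of the definite subbundle with `σ * δ = -(-1) ^ r` defines a smooth
non-degenerate vector-adjoint field.  Locally it is a positive form twisted by
the oriented volume element; the forms of this kind at a point make up a convex set. -/
theorem IsDefiniteSplitting.exists_field [T2Space M] [SigmaCompactSpace M]
    [FiniteDimensional ℂ F] (c : SpinorBundleStructure F S g) {δ σ : ℝ} (hδ : δ = 1 ∨ δ = -1)
    (hσ2 : σ = 1 ∨ σ = -1) {r r' : ℕ} (hσ : σ * δ = -(-1) ^ r)
    (hW : IsDefiniteSplitting g δ r r' W W') (hO : IsOrientableSubbundle r W) :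
    ∃ H : ∀ x : M, S x →ₗ⋆[ℂ] S x →ₗ[ℂ] ℂ, IsSmoothSesquilinearField (q := q) (p := p) F H ∧
      ∀ x, IsVectorAdjoint σ (c.rep x) (H x) ∧ (H x).Nondegenerate := by
  obtain ⟨-, τ, hτ0, hτs⟩ := hO
  obtain ⟨H, hH, hHs⟩ := exists_good_section (n := q + p) (M := M)
    (X := fun x ↦ S x →ₗ⋆[ℂ] S x →ₗ[ℂ] ℂ)
    (fun x H ↦ IsVectorAdjoint σ (c.rep x) H ∧ IsOrientedForm (c.rep x) δ (τ x) H)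
    (fun x a b t ↦ ((1 - t : ℝ) : ℂ) • a + (t : ℂ) • b)
    (fun H x ↦ ∃ U : Set M, IsOpen U ∧ x ∈ U ∧ IsSmoothFieldOn F (q + p) U H)
    (fun x a b _ _ ↦ by simp) (fun x a b _ _ ↦ by simp)
    (fun x a b t ha hb ht0 ht1 ↦ ⟨ha.1.add_smul hb.1 _ _, ha.2.interp hb.2 ht0 ht1⟩)
    (fun H H' x h hH ↦ by
      obtain ⟨U, hU, hx, hUH⟩ := hH
      obtain ⟨V, hV, hVo, hxV⟩ := eventually_nhds_iff.mp h
      refine ⟨U ∩ V, hU.inter hVo, ⟨hx, hxV⟩, fun V' hV' hV'o ψ φ hψ hφ ↦ ?_⟩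
      exact (hUH V' (hV'.trans Set.inter_subset_left) hV'o ψ φ hψ hφ).congr fun y hy ↦ by
        rw [hV y (hV' hy).2])
    (fun χ H H' x hχ _ _ _ h h' ↦ by
      obtain ⟨U, hU, hx, hUH⟩ := h
      obtain ⟨U', hU', hx', hUH'⟩ := h'
      refine ⟨U ∩ U', hU.inter hU', ⟨hx, hx'⟩, fun V hV hVo ψ φ hψ hφ ↦ ?_⟩
      exact (contMDiffOn_complex_mul
        (contMDiffOn_ofReal (contMDiffOn_const.sub hχ.contMDiffOn))
        (hUH V (hV.trans Set.inter_subset_left) hVo ψ φ hψ hφ)).add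
        (contMDiffOn_complex_mul (contMDiffOn_ofReal hχ.contMDiffOn)
        (hUH' V (hV.trans Set.inter_subset_right) hVo ψ φ hψ hφ)))
    (fun x₀ ↦ by
      obtain ⟨U, hU, hx₀, e, f, he, hf, hef⟩ := hW.exists_adaptedFrame hδ x₀
      obtain ⟨U', hU', hx₀', m, hm, hmpos⟩ :=
        exists_posDef_field (n := q + p) (F := F) (S := S) x₀
      have hUU := hU.inter hU'
      let E : Fin r → ∀ x : M, TangentSpace (𝓡 (q + p)) x := fun i x ↦ e i x
      let E' : Fin r' → ∀ x : M, TangentSpace (𝓡 (q + p)) x := fun i x ↦ f i x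
      have hE : ∀ i, SmoothVectorFieldOn (U ∩ U') (E i) :=
        fun i ↦ (he.smooth i).mono Set.inter_subset_left
      have hE' : ∀ i, SmoothVectorFieldOn (U ∩ U') (E' i) :=
        fun i ↦ (hf.smooth i).mono Set.inter_subset_left
      have hm' : IsSmoothFieldOn F (q + p) (U ∩ U') m :=
        fun V hV ↦ hm V (hV.trans Set.inter_subset_right)
      have h1 := hm'.averageForm c (List.ofFn E ++ List.ofFn E') (fun X hX ↦ by
        rcases List.mem_append.mp hX with h | h <;> obtain ⟨i, rfl⟩ := (List.mem_ofFn' _ _).mp h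
        exacts [hE i, hE' i])
      have hlist : ∀ x, ((List.ofFn E ++ List.ofFn E').map fun X ↦
          realAction (c.rep x) (CliffordAlgebra.ι (g.quad x) (X x))) =
          frameOperators (c.rep x) (fun i ↦ E i x) (fun i ↦ E' i x) := fun x ↦ by
        rw [frameOperators, List.map_append, List.map_append, List.map_ofFn, List.map_ofFn,
          List.map_ofFn, List.map_ofFn]
        rfl
      simp only [hlist] at h1
      have h2 := h1.volumeForm c δ E hE (t := fun x ↦ τ x fun i ↦ e i x) (hτs _ hUU e hE)
      refine ⟨_, (hUU.eventually_mem ⟨hx₀, hx₀'⟩).mono fun x hx ↦ ⟨⟨?_, ?_⟩, U ∩ U', hUU, hx, h2⟩⟩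
      · exact isVectorAdjoint_volumeForm
          ((hef x hx.1).isCompatibleForm_averageForm hδ (hmpos x hx.2)) (hef x hx.1) hδ hσ2 hσ _
      · have h3 := IsAdaptedFrame.isOrientedForm_volumeForm (ρ := c.rep x) (τ := τ x)
          (b := he.basis hδ hx.1) (f := fun i ↦ E' i x)
          (by rw [he.coe_basis hδ hx.1]; exact hef x hx.1) hδ
          (isPosDefForm_averageForm (hmpos x hx.2)
            (frameOperators (c.rep x) (fun i ↦ E i x) (fun i ↦ E' i x))) (hτ0 x)
        rw [he.coe_basis hδ hx.1] at h3
        exact h3)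
  refine ⟨H, fun U hU ψ φ hψ hφ x hx ↦ ?_, fun x ↦
    ⟨(hH x).1, (hH x).2.nondegenerate (hH x).1 (hτ0 x)⟩⟩
  obtain ⟨V, hV, hxV, hVH⟩ := hHs x
  have := hVH (V ∩ U) Set.inter_subset_left (hV.inter hU) ψ φ
    (ContMDiffOn.mono hψ Set.inter_subset_right) (ContMDiffOn.mono hφ Set.inter_subset_right)
  exact ((this x ⟨hxV, hx⟩).contMDiffAt ((hV.inter hU).mem_nhds ⟨hxV, hx⟩)).contMDiffWithinAt

end ProductOfOrientation

/-! ### Products and orientability -/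

section Equivalences

variable {q p : ℕ} {M : Type*} [TopologicalSpace M] [T2Space M] [SigmaCompactSpace M]
  [ChartedSpace (EuclideanSpace ℝ (Fin (q + p))) M] [IsManifold (𝓡 (q + p)) ∞ M]
  {g : SemiRiemannianMetric q p M}

theorem isPositiveOrientable_iff_isNegativeOrientable (hM : IsOrientableManifold (q + p) M) :
    IsPositiveOrientable g ↔ IsNegativeOrientable g := by
  constructor
  · rintro ⟨W, W', hs, hO⟩
    exact ⟨W, W', hs, hs.isDefiniteSplitting_pos.isOrientableSubbundle_compl (Or.inl rfl)
      ((Equiv.sumComm _ _).trans finSumFinEquiv) hM hO⟩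
  · rintro ⟨W, W', hs, hO⟩
    exact ⟨W, W', hs, hs.isDefiniteSplitting_neg.isOrientableSubbundle_compl (Or.inr rfl)
      finSumFinEquiv hM hO⟩

variable {F : Type*} [NormedAddCommGroup F] [NormedSpace ℂ F] [FiniteDimensional ℂ F]
  {S : M → Type*} [TopologicalSpace (TotalSpace F S)] [∀ x, TopologicalSpace (S x)]
  [∀ x, AddCommGroup (S x)] [∀ x, Module ℂ (S x)]
  [FiberBundle F S] [VectorBundle ℂ F S] [VectorBundle ℝ F S]
  [ContMDiffVectorBundle ∞ F S (𝓡 (q + p))] (c : SpinorBundleStructure F S g) {σ : ℝ}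

/-- For `σ = (-1) ^ q` the volume element of the negative part does the twist. -/
theorem exists_field_iff_isNegativeOrientable (hσ : σ = (-1) ^ q) :
    (∃ H : ∀ x : M, S x →ₗ⋆[ℂ] S x →ₗ[ℂ] ℂ, IsSmoothSesquilinearField (q := q) (p := p) F H ∧
      ∀ x, IsVectorAdjoint σ (c.rep x) (H x) ∧ (H x).Nondegenerate) ↔
    IsNegativeOrientable g := by
  have hσ2 : σ = 1 ∨ σ = -1 := hσ ▸ neg_one_pow_eq_or ℝ q
  have hσ' : σ * -1 = -(-1) ^ q := by rw [hσ]; ring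
  constructor
  · rintro ⟨H, hHs, hH⟩
    obtain ⟨W, W', hs⟩ := exists_isSplitting g
    exact ⟨W, W', hs, hs.isDefiniteSplitting_neg.isOrientableSubbundle_of_field c (Or.inr rfl) hσ2
      hσ' hHs hH⟩
  · rintro ⟨W, W', hs, hO⟩
    exact hs.isDefiniteSplitting_neg.exists_field c (Or.inr rfl) hσ2 hσ' hO

/-- For `σ = -(-1) ^ p` the volume element of the positive part does the twist. -/
theorem exists_field_iff_isPositiveOrientable (hσ : σ = -(-1) ^ p) :
    (∃ H : ∀ x : M, S x →ₗ⋆[ℂ] S x →ₗ[ℂ] ℂ, IsSmoothSesquilinearField (q := q) (p := p) F H ∧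
      ∀ x, IsVectorAdjoint σ (c.rep x) (H x) ∧ (H x).Nondegenerate) ↔
    IsPositiveOrientable g := by
  have hσ2 : σ = 1 ∨ σ = -1 := by
    rcases neg_one_pow_eq_or ℝ p with h | h <;> simp [hσ, h]
  have hσ' : σ * 1 = -(-1) ^ p := by rw [hσ, mul_one]
  constructor
  · rintro ⟨H, hHs, hH⟩
    obtain ⟨W, W', hs⟩ := exists_isSplitting g
    exact ⟨W, W', hs, hs.isDefiniteSplitting_pos.isOrientableSubbundle_of_field c (Or.inl rfl) hσ2
      hσ' hHs hH⟩
  · rintro ⟨W, W', hs, hO⟩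
    exact hs.isDefiniteSplitting_pos.exists_field c (Or.inl rfl) hσ2 hσ' hO

end Equivalences

end SpinGeometry

end

theorem mainTheorem4 {q p : ℕ} (hpos : 0 < q + p) (heven : Even (q + p))
    {M : Type*} [TopologicalSpace M] [T2Space M] [SigmaCompactSpace M]
    [ChartedSpace (EuclideanSpace ℝ (Fin (q + p))) M] [IsManifold (𝓡 (q + p)) ∞ M]
    (g : SpinGeometry.SemiRiemannianMetric q p M)
    {F : Type*} [NormedAddCommGroup F] [NormedSpace ℂ F] [FiniteDimensional ℂ F]
    {S : M → Type*} [TopologicalSpace (TotalSpace F S)] [∀ x, TopologicalSpace (S x)]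
    [∀ x, AddCommGroup (S x)] [∀ x, Module ℂ (S x)]
    [∀ x, IsTopologicalAddGroup (S x)] [∀ x, ContinuousSMul ℂ (S x)]
    [FiberBundle F S] [VectorBundle ℂ F S] [VectorBundle ℝ F S]
    [ContMDiffVectorBundle ∞ F S (𝓡 (q + p))]
    (c : SpinGeometry.SpinorBundleStructure F S g) :
    ((Even q ∧ Even p) →
      (SpinGeometry.HasLocalRobinsonProduct c ↔ SpinGeometry.IsNegativeOrientable g) ∧
      (SpinGeometry.HasLocalAntiRobinsonProduct c ↔ SpinGeometry.IsPositiveOrientable g)) ∧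
    ((Odd q ∧ Odd p) →
      (SpinGeometry.HasLocalRobinsonProduct c ↔ SpinGeometry.IsPositiveOrientable g) ∧
      (SpinGeometry.HasLocalAntiRobinsonProduct c ↔ SpinGeometry.IsNegativeOrientable g)) ∧
    (SpinGeometry.IsOrientableManifold (q + p) M →
      [SpinGeometry.IsSpaceTimeOrientable g,
        SpinGeometry.IsNegativeOrientable g,
        SpinGeometry.IsPositiveOrientable g,
        SpinGeometry.HasLocalRobinsonProduct c,
        SpinGeometry.HasLocalAntiRobinsonProduct c].TFAE) := by
  have hEven : (Even q ∧ Even p) →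
      (SpinGeometry.HasLocalRobinsonProduct c ↔ SpinGeometry.IsNegativeOrientable g) ∧
      (SpinGeometry.HasLocalAntiRobinsonProduct c ↔ SpinGeometry.IsPositiveOrientable g) := by
    rintro ⟨hq, hp⟩
    simp only [SpinGeometry.HasLocalRobinsonProduct, SpinGeometry.HasLocalAntiRobinsonProduct,
      SpinGeometry.isRobinsonProduct_iff, SpinGeometry.isAntiRobinsonProduct_iff]
    exact ⟨SpinGeometry.exists_field_iff_isNegativeOrientable c (by rw [hq.neg_one_pow]),
      SpinGeometry.exists_field_iff_isPositiveOrientable c (by rw [hp.neg_one_pow])⟩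
  have hOdd : (Odd q ∧ Odd p) →
      (SpinGeometry.HasLocalRobinsonProduct c ↔ SpinGeometry.IsPositiveOrientable g) ∧
      (SpinGeometry.HasLocalAntiRobinsonProduct c ↔ SpinGeometry.IsNegativeOrientable g) := by
    rintro ⟨hq, hp⟩
    simp only [SpinGeometry.HasLocalRobinsonProduct, SpinGeometry.HasLocalAntiRobinsonProduct,
      SpinGeometry.isRobinsonProduct_iff, SpinGeometry.isAntiRobinsonProduct_iff]
    exact ⟨SpinGeometry.exists_field_iff_isPositiveOrientable c (by rw [hp.neg_one_pow, neg_neg]),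
      SpinGeometry.exists_field_iff_isNegativeOrientable c (by rw [hq.neg_one_pow])⟩
  refine ⟨hEven, hOdd, fun hM ↦ ?_⟩
  have hpn := SpinGeometry.isPositiveOrientable_iff_isNegativeOrientable (g := g) hM
  tfae_have 1 → 2 := fun h ↦ h.1
  tfae_have 2 → 1 := fun h ↦ ⟨h, hpn.mpr h⟩
  tfae_have 3 ↔ 2 := hpn
  tfae_have 4 ↔ 2 := by
    by_cases hq : Even q
    · exact (hEven ⟨hq, (Nat.even_add.mp heven).mp hq⟩).1
    · exact (hOdd ⟨Nat.not_even_iff_odd.mp hq,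
        Nat.not_even_iff_odd.mp (mt (Nat.even_add.mp heven).mpr hq)⟩).1.trans hpn
  tfae_have 5 ↔ 2 := by
    by_cases hq : Even q
    · exact (hEven ⟨hq, (Nat.even_add.mp heven).mp hq⟩).2.trans hpn
    · exact (hOdd ⟨Nat.not_even_iff_odd.mp hq,
        Nat.not_even_iff_odd.mp (mt (Nat.even_add.mp heven).mpr hq)⟩).2
  tfae_finish
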